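/- Let $\xi=(\xi_1,\dots,\xi_p)$ and $\eta=(\eta_1,\dots,\eta_q)$ be jointly Gaussian real random vectors with nonsingular covariance matrices $R_\xi,R_\eta$ and cross-covariance matrix $R_{\xi\eta}$, such that the joint law $P_{\xi\eta}$ is absolutely continuous with respect to $P_\xi\otimes P_\eta$. Let $i(\xi;\eta)=\log\frac{dP_{\xi\eta}}{d(P_\xi\otimes P_\eta)}(\xi,\eta)$ be the information density, $I=\mathbb E[i(\xi;\eta)]$ the mutual information, $r=\operatorname{rank}R_{\xi\eta}\ge 2$, and let $\rho_1\ge\dots\ge\rho_r>0$ be the canonical correlations, i.e. the positive singular values of $R_\xi^{-1/2}R_{\xi\eta}R_\eta^{-1/2}$. Let $\mathrm K_\alpha$ be the modified Bessel function of the second kind and $\mathrm L_\alpha$ the modified Struve function. For $k\in\mathbb N_0$ and $z\ge 0$ put $$\mathrm U_k(z)=\frac{\mathrm K_{\frac{r-1}2+k}(z)}{\Gamma(\frac r2+k)}\Big(\frac z2\Big)^{\frac{r-1}2+k}\ \ (z>0),\qquad \mathrm U_k(0)=\lim_{z\to 0+}\mathrm U_k(z)=\frac{\Gamma(\frac{r-1}2+k)}{2\,\Gamma(\frac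 r2+k)},$$ $$\mathrm D_k(z)=\frac{z}{2\rho_r}\Big[\mathrm K_{\frac{r-1}2+k}\big(\tfrac z{\rho_r}\big)\mathrm L_{\frac{r-3}2+k}\big(\tfrac z{\rho_r}\big)+\mathrm K_{\frac{r-3}2+k}\big(\tfrac z{\rho_r}\big)\mathrm L_{\frac{r-1}2+k}\big(\tfrac z{\rho_r}\big)\Big]\ \ (z>0),\qquad \mathrm D_k(0)=0,$$ $$\delta_k=\sum_{k_1+\dots+k_{r-1}=k}\ \prod_{i=1}^{r-1}\frac{(2k_i)!}{(k_i!)^2 4^{k_i}}\Big(1-\frac{\rho_r^2}{\rho_i^2}\Big)^{k_i},\qquad \Pi=\prod_{i=1}^{r-1}\frac{\rho_r}{\rho_i},$$ $$V(z)=\sum_{k_1=0}^\infty\cdots\sum_{k_{r-1}=0}^\infty\Big[\prod_{i=1}^{r-1}\frac{\rho_r}{\rho_i}\frac{(2k_i)!}{(k_i!)^2 4^{k_i}}\Big(1-\frac{\rho_r^2}{\rho_i^2}\Big)^{k_i}\Big]\mathrm D_{k_1+\dots+k_{r-1}}(z),\qquad z\ge 0,$$ and for $n\in\mathbb N_0$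 $$\hat f(x,n)=\frac{\Pi}{\rho_r\sqrt\pi}\sum_{k=0}^n\delta_k\,\mathrm U_k\Big(\Big|\frac{x-I}{\rho_r}\Big|\Big),\qquad \hat V(z,n)=\Pi\sum_{k=0}^n\delta_k\,\mathrm D_k(z),$$ $$\hat F(x,n)=\tfrac12-\hat V(I-x,n)\ \text{ if } x\le I,\qquad \hat F(x,n)=\tfrac12+\hat V(x-I,n)\ \text{ if } x>I.$$ Then $i(\xi;\eta)$ has a continuous probability density $f$, the series defining $V(z)$ converges for every $z\ge 0$, and, with $F$ the CDF of $i(\xi;\eta)$, for all $n\in\mathbb N_0$ $$|f(x)-\hat f(x,n)|\le\frac{\Gamma(\frac{r-1}2+n)}{2\rho_r\sqrt\pi\,\Gamma(\frac r2+n)}\Big(1-\Pi\sum_{k=0}^n\delta_k\Big),\qquad x\in\mathbb R,$$ $$|V(z)-\hat V(z,n)|\le\frac12\Big(1-\Pi\sum_{k=0}^n\delta_k\Big),\qquad z\ge 0,$$ and consequently $$|F(x)-\hat F(x,n)|\le\frac12\Big(1-\Pi\sum_{k=0}^n\delta_k\Big),\qquad x\in\mathbb R.$$ -/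

import Mathlib

open MeasureTheory ProbabilityTheory
open scoped MatrixOrder

noncomputable section

namespace InfoDensity

/-! ### Special functions -/

/-- Modified Bessel function of the second kind `K_α(y)` for real order `α` and `y > 0`:
`K_α(y) = ∫_0^∞ exp(-y cosh t) cosh(α t) dt`. -/
def besselK (α y : ℝ) : ℝ :=
  ∫ t in Set.Ioi (0 : ℝ), Real.exp (-y * Real.cosh t) * Real.cosh (α * t)

/-- Modified Struve function `L_α(y)` for real order `α` and `y > 0`:
`L_α(y) = (y/2)^(α+1) ∑_m (y/2)^(2m) / (Γ(m + 3/2) Γ(m + α + 3/2))`. -/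
def struveL (α y : ℝ) : ℝ :=
  (y / 2) ^ (α + 1) *
    ∑' m : ℕ, (y / 2) ^ (2 * m) / (Real.Gamma (m + 3 / 2) * Real.Gamma (m + α + 3 / 2))

/-! ### Information density, mutual information, canonical correlations -/

section Random

variable {Ω : Type*} [MeasurableSpace Ω]

/-- The information density `i(X;Y) = log (dP_{XY} / d(P_X ⊗ P_Y)) (X, Y)`. -/
def infoDensity {E F : Type*} [MeasurableSpace E] [MeasurableSpace F]
    (P : Measure Ω) (X : Ω → E) (Y : Ω → F) (ω : Ω) : ℝ :=
  Real.log
    (((P.map fun ω => (X ω, Y ω)).rnDeriv ((P.map X).prod (P.map Y)) (X ω, Y ω)).toReal)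

/-- The mutual information `I(X;Y)`, the expectation of the information density. -/
def mutualInfo {E F : Type*} [MeasurableSpace E] [MeasurableSpace F]
    (P : Measure Ω) (X : Ω → E) (Y : Ω → F) : ℝ :=
  ∫ ω, infoDensity P X Y ω ∂P

/-- The (cross-)covariance matrix of two random vectors. -/
def covMatrix {p q : ℕ} (P : Measure Ω) (X : Ω → EuclideanSpace ℝ (Fin p))
    (Y : Ω → EuclideanSpace ℝ (Fin q)) : Matrix (Fin p) (Fin q) ℝ :=
  Matrix.of fun i j => covariance (fun ω => X ω i) (fun ω => Y ω j) P

/-- The matrix `R_X^{-1/2} R_{XY} R_Y^{-1/2}`. -/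
def coherenceMatrix {p q : ℕ} (P : Measure Ω) (X : Ω → EuclideanSpace ℝ (Fin p))
    (Y : Ω → EuclideanSpace ℝ (Fin q)) : Matrix (Fin p) (Fin q) ℝ :=
  (CFC.sqrt (covMatrix P X X))⁻¹ * covMatrix P X Y * (CFC.sqrt (covMatrix P Y Y))⁻¹

/-- The canonical correlations of `X` and `Y`: the singular values of
`R_X^{-1/2} R_{XY} R_Y^{-1/2}` in descending order, indexed from `0`. With `r = rank R_{XY}`, the
positive ones `ρ_1 ≥ ... ≥ ρ_r` are the values at `0, ..., r - 1`; all later values are `0`. -/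
def canonicalCorr {p q : ℕ} (P : Measure Ω) (X : Ω → EuclideanSpace ℝ (Fin p))
    (Y : Ω → EuclideanSpace ℝ (Fin q)) (i : ℕ) : ℝ :=
  (Matrix.toEuclideanLin (coherenceMatrix P X Y)).singularValues i

end Random

/-! ### The series and their truncations

Below `r` is the number of canonical correlations and `ρ i` is the `(i+1)`-st of them, so that
`ρ (r - 1)` is the smallest one. -/

/-- `(2k)! / ((k!)² 4^k) * (1 - ρ_r² / ρ_i²)^k`. -/
def coeffFactor (r : ℕ) (ρ : ℕ → ℝ) (i k : ℕ) : ℝ :=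
  ((2 * k).factorial : ℝ) / ((k.factorial : ℝ) ^ 2 * 4 ^ k) *
    (1 - ρ (r - 1) ^ 2 / ρ i ^ 2) ^ k

/-- `∏_{i=1}^{r-1} ρ_r / ρ_i`. -/
def corrProd (r : ℕ) (ρ : ℕ → ℝ) : ℝ :=
  ∏ i : Fin (r - 1), ρ (r - 1) / ρ i

/-- `δ_k`, the sum over all `(k_1, ..., k_{r-1})` with `k_1 + ... + k_{r-1} = k` of
`∏_i (2 k_i)! / ((k_i!)² 4^{k_i}) * (1 - ρ_r² / ρ_i²)^{k_i}`. -/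
def delta (r : ℕ) (ρ : ℕ → ℝ) (k : ℕ) : ℝ :=
  ∑ κ ∈ Finset.piAntidiag (Finset.univ : Finset (Fin (r - 1))) k,
    ∏ i : Fin (r - 1), coeffFactor r ρ i (κ i)

/-- `U_k(z) = K_{(r-1)/2+k}(z) / Γ(r/2+k) * (z/2)^{(r-1)/2+k}` for `z > 0`; at `z = 0` it is
the limit `Γ((r-1)/2+k) / (2 Γ(r/2+k))` from the right. -/
def funU (r k : ℕ) (z : ℝ) : ℝ :=
  if z = 0 then Real.Gamma (((r : ℝ) - 1) / 2 + k) / (2 * Real.Gamma ((r : ℝ) / 2 + k))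
  else besselK (((r : ℝ) - 1) / 2 + k) z / Real.Gamma ((r : ℝ) / 2 + k) *
    (z / 2) ^ (((r : ℝ) - 1) / 2 + k)

/-- `D_k(z)`, for `z ≥ 0`. -/
def funD (r : ℕ) (ρ : ℕ → ℝ) (k : ℕ) (z : ℝ) : ℝ :=
  z / (2 * ρ (r - 1)) *
    (besselK (((r : ℝ) - 1) / 2 + k) (z / ρ (r - 1)) *
        struveL (((r : ℝ) - 3) / 2 + k) (z / ρ (r - 1)) +
      besselK (((r : ℝ) - 3) / 2 + k) (z / ρ (r - 1)) *
        struveL (((r : ℝ) - 1) / 2 + k) (z / ρ (r - 1)))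

/-- The summand with index `(k_1, ..., k_{r-1})` of the multiple series for `V(z)`. -/
def termV (r : ℕ) (ρ : ℕ → ℝ) (z : ℝ) (κ : Fin (r - 1) → ℕ) : ℝ :=
  (∏ i : Fin (r - 1), ρ (r - 1) / ρ i * coeffFactor r ρ i (κ i)) * funD r ρ (∑ i, κ i) z

/-- The function `V(z)`, `z ≥ 0`, that specifies the CDF of the information density, as a
multiple series over `(k_1, ..., k_{r-1})`. -/
def funV (r : ℕ) (ρ : ℕ → ℝ) (z : ℝ) : ℝ :=
  ∑' κ : Fin (r - 1) → ℕ, termV r ρ z κ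

/-- The finite sum approximation of the PDF; `I` is the mutual information. -/
def approxPDF (r : ℕ) (ρ : ℕ → ℝ) (I : ℝ) (n : ℕ) (x : ℝ) : ℝ :=
  1 / (ρ (r - 1) * √Real.pi) * corrProd r ρ *
    ∑ k ∈ Finset.range (n + 1), delta r ρ k * funU r k |(x - I) / ρ (r - 1)|

/-- The finite sum approximation of `V`. -/
def approxV (r : ℕ) (ρ : ℕ → ℝ) (n : ℕ) (z : ℝ) : ℝ :=
  corrProd r ρ * ∑ k ∈ Finset.range (n + 1), delta r ρ k * funD r ρ k z

/-- The finite sum approximation of the CDF; `I` is the mutual information. -/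
def approxCDF (r : ℕ) (ρ : ℕ → ℝ) (I : ℝ) (n : ℕ) (x : ℝ) : ℝ :=
  if x ≤ I then 1 / 2 - approxV r ρ n (I - x) else 1 / 2 + approxV r ρ n (x - I)

/-- `1 - (∏_{i=1}^{r-1} ρ_r / ρ_i) ∑_{k=0}^n δ_k`. -/
def remainder (r : ℕ) (ρ : ℕ → ℝ) (n : ℕ) : ℝ :=
  1 - corrProd r ρ * ∑ k ∈ Finset.range (n + 1), delta r ρ k

end InfoDensity

end

/-! The law of the information density is found twice through its characteristic function, once from
the Gaussian model and once as a mixture, and truncating the mixture gives all three bounds.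

Gaussian side. Whitening both vectors turns the product law into a standard Gaussian and the joint
covariance into `1 + offDiag C`, with `C` the coherence matrix. Rotating to eigenvectors of `offDiag
C` makes both laws products of centred one-dimensional Gaussians (`exists_diagonalization`), so the
log density is a constant plus a diagonal quadratic form. Since `offDiag C` has trace zero, that
form has mean zero and the constant is `I`. The characteristic function is `exp(i t I) ∏ (1 + ρ_i²
t²)^(-1/2)` (`charFun_infoDensity_eq`).

Mixture side. With `c = 1 + ρ_r² t²` one has `1 + ρ_i² t² = (ρ_i/ρ_r)² c (1 - (1 - ρ_r²/ρ_i²)/c)`.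
Binomial series in `1/c` for `i < r` write the product as `∑ Π δ_k c^(-(r/2+k))`
(`hasSum_mixWeight_charFun`). As `ρ_r` is the smallest correlation, the weights `Π δ_k` are
nonnegative, and they sum to 1. Each power of `1/c` is the characteristic function of a scaled
symmetric variance gamma law, whose density is a Bessel function (`integral_gigIntegral_mul_cexp`,
`funU_abs_eq`) and whose integral from 0 is `D_k` by a Bessel–Struve identity
(`besselK_struveL_eq_intervalIntegral`).

Hence the density is the mixture, and `remainder` is the total weight of the omitted components
(`remainder_eq_tsum`). Each omitted density is at most its value at 0, which decreases in `k`, and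
each omitted `D_k` is at most 1/2, the mass of a half-line (`abs_tsum_sub_sum_le`). -/

noncomputable section

namespace InfoDensity

/-! ### An integral representation of the modified Bessel function -/

/-- The integrand `s ^ (ν - 1) * exp (-s - z² / (4 s))` of `gigIntegral`. -/
def gigIntegrand (ν z s : ℝ) : ℝ := s ^ (ν - 1) * Real.exp (-s - z ^ 2 / (4 * s))

/-- `∫_0^∞ s ^ (ν - 1) * exp (-s - z² / (4 s)) ds`, the normalizing constant of a generalized
inverse Gaussian distribution. For `z > 0` it equals `2 (z / 2) ^ ν K_ν(z)`. -/
def gigIntegral (ν z : ℝ) : ℝ := ∫ s in Set.Ioi (0 : ℝ), gigIntegrand ν z s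

lemma measurable_gigIntegrand (ν z : ℝ) : Measurable (gigIntegrand ν z) := by
  unfold gigIntegrand; fun_prop

lemma gigIntegrand_nonneg (ν z : ℝ) {s : ℝ} (hs : 0 < s) : 0 ≤ gigIntegrand ν z s :=
  mul_nonneg (Real.rpow_nonneg hs.le _) (Real.exp_nonneg _)

lemma gigIntegral_nonneg (ν z : ℝ) : 0 ≤ gigIntegral ν z :=
  setIntegral_nonneg measurableSet_Ioi fun _ hs => gigIntegrand_nonneg ν z hs

lemma gigIntegrand_le (ν z : ℝ) {s : ℝ} (hs : 0 < s) :
    gigIntegrand ν z s ≤ Real.exp (-s) * s ^ (ν - 1) := by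
  rw [gigIntegrand, mul_comm]
  gcongr
  have : 0 ≤ z ^ 2 / (4 * s) := by positivity
  linarith

lemma integrableOn_gigIntegrand_of_pos {ν : ℝ} (hν : 0 < ν) (z : ℝ) :
    IntegrableOn (gigIntegrand ν z) (Set.Ioi 0) := by
  refine (Real.GammaIntegral_convergent hν).mono' (measurable_gigIntegrand ν z).aestronglyMeasurable
    ?_
  filter_upwards [ae_restrict_mem measurableSet_Ioi] with s hs
  rw [Real.norm_of_nonneg (gigIntegrand_nonneg ν z hs)]
  exact gigIntegrand_le ν z hs

/-- For `z ≠ 0` the factor `exp(-z²/(4s))` beats every power of `s` at 0, so `ν` may be raised by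
`n` until a Gamma integrand dominates. Nonpositive orders are needed for derivatives and
reflections. -/
lemma integrableOn_gigIntegrand (ν : ℝ) {z : ℝ} (hz : z ≠ 0) :
    IntegrableOn (gigIntegrand ν z) (Set.Ioi 0) := by
  obtain ⟨n, hn⟩ := exists_nat_gt (-ν)
  have hc : 0 < z ^ 2 / 4 := by positivity
  have hg := (Real.GammaIntegral_convergent (s := ν + n) (by linarith)).const_mul
    ((n.factorial : ℝ) / (z ^ 2 / 4) ^ n)
  refine hg.mono' (measurable_gigIntegrand ν z).aestronglyMeasurable ?_
  filter_upwards [ae_restrict_mem measurableSet_Ioi] with s hs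
  have hs : 0 < s := hs
  rw [Real.norm_of_nonneg (gigIntegrand_nonneg ν z hs), gigIntegrand]
  have h1 := Real.pow_div_factorial_le_exp (z ^ 2 / (4 * s)) (by positivity) n
  have h2 : Real.exp (-(z ^ 2 / (4 * s))) ≤ (n.factorial : ℝ) / (z ^ 2 / (4 * s)) ^ n := by
    rw [Real.exp_neg]
    calc _ ≤ ((z ^ 2 / (4 * s)) ^ n / (n.factorial : ℝ))⁻¹ := by gcongr
      _ = _ := by rw [inv_div]
  calc s ^ (ν - 1) * Real.exp (-s - z ^ 2 / (4 * s))
      = s ^ (ν - 1) * Real.exp (-s) * Real.exp (-(z ^ 2 / (4 * s))) := by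
        rw [sub_eq_add_neg (-s), Real.exp_add]; ring
    _ ≤ s ^ (ν - 1) * Real.exp (-s) * ((n.factorial : ℝ) / (z ^ 2 / (4 * s)) ^ n) := by gcongr
    _ = _ := by
        have : s ^ (ν + n - 1) = s ^ (ν - 1) * s ^ n := by
          rw [← Real.rpow_natCast, ← Real.rpow_add hs]; congr 1; ring
        rw [this]
        have : z ^ 2 / (4 * s) = z ^ 2 / 4 / s := by field_simp
        rw [this, div_pow]
        field_simp

lemma gigIntegral_zero {ν : ℝ} (hν : 0 < ν) : gigIntegral ν 0 = Real.Gamma ν := by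
  rw [gigIntegral, Real.Gamma_eq_integral hν]
  refine setIntegral_congr_fun measurableSet_Ioi fun s _ => ?_
  simp [gigIntegrand, mul_comm]

lemma gigIntegral_le_Gamma {ν : ℝ} (hν : 0 < ν) (z : ℝ) : gigIntegral ν z ≤ Real.Gamma ν := by
  rw [gigIntegral, Real.Gamma_eq_integral hν]
  exact setIntegral_mono_on (integrableOn_gigIntegrand_of_pos hν z)
    (Real.GammaIntegral_convergent hν) measurableSet_Ioi fun s hs => gigIntegrand_le ν z hs

lemma continuous_gigIntegral {ν : ℝ} (hν : 0 < ν) : Continuous (gigIntegral ν) := by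
  refine continuous_of_dominated (fun z => (measurable_gigIntegrand ν z).aestronglyMeasurable)
    (fun z => ?_) (Real.GammaIntegral_convergent hν) ?_
  · filter_upwards [ae_restrict_mem measurableSet_Ioi] with s hs
    rw [Real.norm_of_nonneg (gigIntegrand_nonneg ν z hs)]
    exact gigIntegrand_le ν z hs
  · filter_upwards [ae_restrict_mem measurableSet_Ioi] with s hs
    unfold gigIntegrand
    fun_prop

lemma gigIntegral_neg (ν z : ℝ) : gigIntegral ν (-z) = gigIntegral ν z := by
  simp [gigIntegral, gigIntegrand]

lemma gigIntegral_abs (ν z : ℝ) : gigIntegral ν |z| = gigIntegral ν z := by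
  simp [gigIntegral, gigIntegrand]

/-- Differentiation under the integral: the factor `-z/(2s)` lowers the order by one. On `(z/2, 2z)`
the integrand is at most its value at `z/2`, which supplies the dominating function. -/
lemma hasDerivAt_gigIntegral (ν : ℝ) {z : ℝ} (hz : 0 < z) :
    HasDerivAt (gigIntegral ν) (-(z / 2) * gigIntegral (ν - 1) z) z := by
  have key := hasDerivAt_integral_of_dominated_loc_of_deriv_le
    (μ := volume.restrict (Set.Ioi (0 : ℝ))) (F := fun z s => gigIntegrand ν z s)
    (F' := fun z s => -(z / 2) * gigIntegrand (ν - 1) z s) (x₀ := z)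
    (s := Set.Ioo (z / 2) (2 * z)) (bound := fun s => z * gigIntegrand (ν - 1) (z / 2) s)
    (Ioo_mem_nhds (by linarith) (by linarith))
    (Filter.Eventually.of_forall fun y => (measurable_gigIntegrand ν y).aestronglyMeasurable)
    (integrableOn_gigIntegrand ν hz.ne')
    (((measurable_gigIntegrand (ν - 1) z).const_mul _).aestronglyMeasurable) ?_
    ((integrableOn_gigIntegrand (ν - 1) (by positivity)).const_mul _) ?_
  · have := key.2
    rwa [integral_const_mul] at this
  · filter_upwards [ae_restrict_mem measurableSet_Ioi] with s hs y hy
    have hs : 0 < s := hs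
    have hy0 : 0 < y := by linarith [hy.1]
    rw [norm_mul, Real.norm_of_nonneg (gigIntegrand_nonneg (ν - 1) y hs), norm_neg,
      Real.norm_of_nonneg (by positivity : 0 ≤ y / 2)]
    have := gigIntegrand_nonneg (ν - 1) y hs
    have h2 : gigIntegrand (ν - 1) y s ≤ gigIntegrand (ν - 1) (z / 2) s := by
      unfold gigIntegrand
      have := hy.1.le
      gcongr
    have := hy.2
    gcongr
    linarith
  · filter_upwards [ae_restrict_mem measurableSet_Ioi] with s hs y hy
    have hs : 0 < s := hs
    unfold gigIntegrand
    have h1 : HasDerivAt (fun y : ℝ => -s - y ^ 2 / (4 * s)) (-(2 * y / (4 * s))) y := by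
      have := ((hasDerivAt_pow 2 y).div_const (4 * s)).const_sub (-s)
      simpa using this
    have h2 := (h1.exp.const_mul (s ^ (ν - 1)))
    refine h2.congr_deriv ?_
    rw [Real.rpow_sub_one hs.ne' (ν - 1)]
    field_simp
    ring

/-- Substitute `s = (z/2) exp t`: the exponent `-s - z²/(4s)` becomes `-z cosh t` and `ds/s` becomes
`dt`. -/
lemma integral_exp_cosh_eq_gigIntegral (ν : ℝ) {z : ℝ} (hz : 0 < z) :
    Integrable (fun t : ℝ => Real.exp (-z * Real.cosh t) * Real.exp (ν * t)) ∧
    ∫ t : ℝ, Real.exp (-z * Real.cosh t) * Real.exp (ν * t) =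
      (z / 2) ^ (-ν) * gigIntegral ν z := by
  have himg : (fun t : ℝ => z / 2 * Real.exp t) '' Set.univ = Set.Ioi 0 := by
    ext s
    simp only [Set.image_univ, Set.mem_range, Set.mem_Ioi]
    constructor
    · rintro ⟨t, rfl⟩; positivity
    · intro hs
      refine ⟨Real.log (s / (z / 2)), ?_⟩
      rw [Real.exp_log (by positivity)]
      field_simp
  have hd : ∀ x ∈ Set.univ, HasDerivWithinAt (fun t : ℝ => z / 2 * Real.exp t)
      (z / 2 * Real.exp x) Set.univ x := fun x _ =>
    ((Real.hasDerivAt_exp x).const_mul _).hasDerivWithinAt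
  have hinj : Set.InjOn (fun t : ℝ => z / 2 * Real.exp t) Set.univ := by
    intro a _ b _ h
    have : z / 2 * Real.exp a = z / 2 * Real.exp b := h
    exact Real.exp_injective (mul_left_cancel₀ (by positivity) this)
  have hpt : ∀ t : ℝ, |z / 2 * Real.exp t| • gigIntegrand ν z (z / 2 * Real.exp t) =
      (z / 2) ^ ν * (Real.exp (-z * Real.cosh t) * Real.exp (ν * t)) := by
    intro t
    have h0 : 0 < z / 2 * Real.exp t := by positivity
    have h1 : -(z / 2 * Real.exp t) - z ^ 2 / (4 * (z / 2 * Real.exp t)) = -z * Real.cosh t := by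
      rw [Real.cosh_eq, Real.exp_neg]
      field_simp
      ring
    rw [abs_of_pos h0, smul_eq_mul, gigIntegrand, Real.rpow_sub_one h0.ne', h1,
      Real.mul_rpow (by positivity) (by positivity), ← Real.exp_mul, mul_comm t ν]
    field_simp
  have h1 := integral_image_eq_integral_abs_deriv_smul MeasurableSet.univ hd hinj (gigIntegrand ν z)
  have h2 := (integrableOn_image_iff_integrableOn_abs_deriv_smul MeasurableSet.univ hd hinj
    (gigIntegrand ν z)).1 (himg ▸ integrableOn_gigIntegrand ν hz.ne')
  simp only [himg, hpt, Measure.restrict_univ, integrableOn_univ] at h1 h2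
  have hp : (z / 2) ^ ν ≠ 0 := (Real.rpow_pos_of_pos (by positivity) ν).ne'
  refine ⟨?_, ?_⟩
  · simpa [← mul_assoc, hp] using h2.const_mul ((z / 2) ^ ν)⁻¹
  · rw [gigIntegral, h1, integral_const_mul, Real.rpow_neg (by positivity), ← mul_assoc,
      inv_mul_cancel₀ hp, one_mul]

lemma besselK_eq_gigIntegral (ν : ℝ) {z : ℝ} (hz : 0 < z) :
    besselK ν z = 1 / 2 * ((z / 2) ^ (-ν) * gigIntegral ν z) := by
  obtain ⟨hi, he⟩ := integral_exp_cosh_eq_gigIntegral ν hz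
  have h1 : ∫ t : ℝ, Real.exp (-z * Real.cosh t) * Real.exp (-(ν * t)) =
      ∫ t : ℝ, Real.exp (-z * Real.cosh t) * Real.exp (ν * t) := by
    rw [← integral_neg_eq_self]
    simp
  have hi' : Integrable (fun t : ℝ => Real.exp (-z * Real.cosh t) * Real.exp (-(ν * t))) := by
    have := hi.comp_neg
    simpa using this
  have h2 : ∫ t : ℝ, Real.exp (-z * Real.cosh t) * Real.cosh (ν * t) =
      (z / 2) ^ (-ν) * gigIntegral ν z := by
    have : ∀ t : ℝ, Real.exp (-z * Real.cosh t) * Real.cosh (ν * t) =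
        1 / 2 * (Real.exp (-z * Real.cosh t) * Real.exp (ν * t) +
          Real.exp (-z * Real.cosh t) * Real.exp (-(ν * t))) := by
      intro t; rw [Real.cosh_eq (ν * t)]; ring
    simp_rw [this]
    rw [integral_const_mul, integral_add hi hi', h1, he]
    ring
  have h3 := integral_comp_abs (f := fun t : ℝ => Real.exp (-z * Real.cosh t) * Real.cosh (ν * t))
  have h4 : ∀ t : ℝ, Real.cosh (ν * |t|) = Real.cosh (ν * t) := by
    intro t
    rcases abs_choice t with h | h <;> simp [h]
  simp only [Real.cosh_abs, h4, h2] at h3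
  rw [besselK, h3]
  ring

lemma besselK_neg_order (ν z : ℝ) : besselK (-ν) z = besselK ν z := by
  simp [besselK]

/-- The reflection `K_{-ν} = K_ν` in the normalization of `gigIntegral`. -/
lemma gigIntegral_neg_order (ν : ℝ) {z : ℝ} (hz : 0 < z) :
    gigIntegral (-ν) z = (z / 2) ^ (-(2 * ν)) * gigIntegral ν z := by
  have h := besselK_neg_order ν z
  rw [besselK_eq_gigIntegral _ hz, besselK_eq_gigIntegral _ hz, neg_neg] at h
  have h2 : (z / 2) ^ ν * gigIntegral (-ν) z = (z / 2) ^ (-ν) * gigIntegral ν z := by linarith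
  have hp : 0 < (z / 2) ^ ν := Real.rpow_pos_of_pos (by positivity) ν
  have h3 : (z / 2) ^ (-(2 * ν)) = (z / 2) ^ (-ν) * ((z / 2) ^ ν)⁻¹ := by
    rw [← Real.rpow_neg (by positivity), ← Real.rpow_add (by positivity)]; congr 1; ring
  rw [h3, mul_right_comm, ← h2]
  field_simp

lemma integrableOn_besselK_integrand (ν : ℝ) {z : ℝ} (hz : 0 < z) :
    IntegrableOn (fun t : ℝ => Real.exp (-z * Real.cosh t) * Real.cosh (ν * t)) (Set.Ioi 0) := by
  have hi := (integral_exp_cosh_eq_gigIntegral ν hz).1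
  have hi' := (integral_exp_cosh_eq_gigIntegral (-ν) hz).1
  refine (((hi.add hi').const_mul (1 / 2)).congr (.of_forall fun t => ?_)).integrableOn
  simp only [Pi.add_apply]
  rw [Real.cosh_eq (ν * t), neg_mul ν t]; ring

lemma besselK_le_of_abs_le {α β z : ℝ} (hz : 0 < z) (h : |α| ≤ |β|) :
    besselK α z ≤ besselK β z := by
  refine setIntegral_mono_on (integrableOn_besselK_integrand α hz)
    (integrableOn_besselK_integrand β hz) measurableSet_Ioi fun t _ => ?_
  have : Real.cosh (α * t) ≤ Real.cosh (β * t) := by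
    rw [Real.cosh_le_cosh, abs_mul, abs_mul]; gcongr
  gcongr

lemma gigIntegrand_eq_mul_exp (ν x s : ℝ) :
    gigIntegrand ν x s =
      s ^ (ν - 1) * Real.exp (-s) * Real.exp (-(1 / (4 * s)) * x ^ 2) := by
  rw [gigIntegrand, mul_assoc, ← Real.exp_add]
  congr 2
  ring

lemma rpow_mul_sqrt_gaussian_normalization (ν : ℝ) {s : ℝ} (hs : 0 < s) :
    s ^ (ν - 1) * √(Real.pi / (1 / (4 * s))) = 2 * √Real.pi * s ^ (ν + 1 / 2 - 1) := by
  have h : Real.pi / (1 / (4 * s)) = 2 ^ 2 * (Real.pi * s) := by field_simp; ring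
  rw [h, Real.sqrt_mul (by positivity), Real.sqrt_sq (by norm_num), Real.sqrt_mul Real.pi_pos.le,
    Real.sqrt_eq_rpow s, add_sub_right_comm, Real.rpow_add hs]
  ring

/-- Integrating over `x` first leaves a Gaussian integral proportional to `√s`, and then the Gamma
integral of order `ν + 1/2`. This licenses Fubini in the Fourier transform. -/
lemma integrable_gigIntegrand_prod {ν : ℝ} (hν : 0 < ν) :
    Integrable (fun q : ℝ × ℝ => gigIntegrand ν q.2 q.1)
      ((volume.restrict (Set.Ioi (0 : ℝ))).prod volume) := by
  have hm : Measurable (fun q : ℝ × ℝ => gigIntegrand ν q.2 q.1) := by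
    unfold gigIntegrand; fun_prop
  rw [integrable_prod_iff hm.aestronglyMeasurable]
  constructor
  · filter_upwards [ae_restrict_mem measurableSet_Ioi] with s hs
    have hs : 0 < s := hs
    simp only [gigIntegrand_eq_mul_exp]
    exact (integrable_exp_neg_mul_sq (by positivity)).const_mul _
  · have hG := (Real.GammaIntegral_convergent (s := ν + 1 / 2) (by linarith)).const_mul
      (2 * √Real.pi)
    refine Integrable.congr hG ?_
    filter_upwards [ae_restrict_mem measurableSet_Ioi] with s hs
    have hs : 0 < s := hs
    have h1 : ∀ x, ‖gigIntegrand ν x s‖ = s ^ (ν - 1) * Real.exp (-s) *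
        Real.exp (-(1 / (4 * s)) * x ^ 2) := fun x => by
      rw [Real.norm_of_nonneg (gigIntegrand_nonneg ν x hs), gigIntegrand_eq_mul_exp]
    simp only [h1]
    rw [integral_const_mul, integral_gaussian, mul_right_comm (s ^ (ν - 1)),
      rpow_mul_sqrt_gaussian_normalization ν hs]
    ring

lemma integrable_gigIntegral {ν : ℝ} (hν : 0 < ν) : Integrable (gigIntegral ν) :=
  (integrable_gigIntegrand_prod hν).integral_prod_right

lemma integral_gigIntegrand_mul_cexp (ν t : ℝ) {s : ℝ} (hs : 0 < s) :
    ∫ x : ℝ, (gigIntegrand ν x s : ℂ) * Complex.exp (t * x * Complex.I) =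
      ((2 * √Real.pi * (s ^ (ν + 1 / 2 - 1) * Real.exp (-((1 + t ^ 2) * s))) : ℝ) : ℂ) := by
  have hb : 0 < ((1 / (4 * s) : ℝ) : ℂ).re := by
    rw [Complex.ofReal_re]; positivity
  have h := fourierIntegral_gaussian hb (t : ℂ)
  have h1 : ∀ x : ℝ, (gigIntegrand ν x s : ℂ) * Complex.exp (t * x * Complex.I) =
      ((s ^ (ν - 1) * Real.exp (-s) : ℝ) : ℂ) *
        (Complex.exp (Complex.I * t * x) * Complex.exp (-((1 / (4 * s) : ℝ) : ℂ) * x ^ 2)) := by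
    intro x
    rw [gigIntegrand_eq_mul_exp]
    push_cast
    rw [show (t * x * Complex.I : ℂ) = Complex.I * t * x by ring]
    ring
  simp_rw [h1]
  rw [integral_const_mul, h]
  have h2 : ((Real.pi : ℂ) / ((1 / (4 * s) : ℝ) : ℂ)) ^ (1 / 2 : ℂ) =
      ((√(Real.pi / (1 / (4 * s))) : ℝ) : ℂ) := by
    rw [Real.sqrt_eq_rpow, ← Complex.ofReal_div, Complex.ofReal_cpow (by positivity)]
    norm_num
  have h3 : Complex.exp (-(t : ℂ) ^ 2 / (4 * ((1 / (4 * s) : ℝ) : ℂ))) =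
      ((Real.exp (-(t ^ 2 * s)) : ℝ) : ℂ) := by
    have : (s : ℂ) ≠ 0 := by exact_mod_cast hs.ne'
    push_cast
    congr 1
    field_simp
  rw [h2, h3, ← Complex.ofReal_mul, ← Complex.ofReal_mul, ← mul_assoc (2 * √Real.pi),
    ← rpow_mul_sqrt_gaussian_normalization ν hs,
    show -((1 + t ^ 2) * s) = -s + -(t ^ 2 * s) by ring, Real.exp_add]
  congr 1
  ring

/-- The Fourier transform of `gigIntegral ν`, up to normalization the characteristic function of a
symmetric variance gamma distribution. -/
lemma integral_gigIntegral_mul_cexp {ν : ℝ} (hν : 0 < ν) (t : ℝ) :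
    ∫ x : ℝ, (gigIntegral ν x : ℂ) * Complex.exp (t * x * Complex.I) =
      ((2 * √Real.pi * Real.Gamma (ν + 1 / 2) * (1 / (1 + t ^ 2)) ^ (ν + 1 / 2) : ℝ) : ℂ) := by
  have hint : Integrable (Function.uncurry fun (s x : ℝ) =>
      (gigIntegrand ν x s : ℂ) * Complex.exp (t * x * Complex.I))
      ((volume.restrict (Set.Ioi (0 : ℝ))).prod volume) := by
    refine (integrable_gigIntegrand_prod hν).ofReal.mul_bdd (c := 1) ?_ (.of_forall fun q => ?_)
    · exact Continuous.aestronglyMeasurable (by fun_prop)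
    · rw [← Complex.ofReal_mul, Complex.norm_exp_ofReal_mul_I]
  have h1 : ∀ x : ℝ, (gigIntegral ν x : ℂ) * Complex.exp (t * x * Complex.I) =
      ∫ s in Set.Ioi (0 : ℝ), (gigIntegrand ν x s : ℂ) * Complex.exp (t * x * Complex.I) := by
    intro x
    rw [integral_mul_const, gigIntegral, ← integral_complex_ofReal]
  simp_rw [h1]
  rw [← integral_integral_swap hint, setIntegral_congr_fun measurableSet_Ioi
    fun s hs => integral_gigIntegrand_mul_cexp ν t hs]
  have := Real.integral_rpow_mul_exp_neg_mul_Ioi (a := ν + 1 / 2) (r := 1 + t ^ 2) (by linarith)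
    (by positivity)
  rw [integral_complex_ofReal, integral_const_mul, this]
  congr 1
  ring

lemma integral_gigIntegral {ν : ℝ} (hν : 0 < ν) :
    ∫ x : ℝ, gigIntegral ν x = 2 * √Real.pi * Real.Gamma (ν + 1 / 2) := by
  have h := integral_gigIntegral_mul_cexp hν 0
  simp only [Complex.ofReal_zero, zero_mul, Complex.exp_zero, mul_one] at h
  rw [integral_complex_ofReal] at h
  simpa using Complex.ofReal_injective h

/-! ### Entire power series and the modified Struve function -/

lemma summable_mul_pow_of_abs_le_div_factorial {c : ℕ → ℝ} {C : ℝ}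
    (hc : ∀ m, |c m| ≤ C / m.factorial) (x : ℝ) : Summable fun m => c m * x ^ m := by
  refine Summable.of_norm_bounded ((Real.summable_pow_div_factorial |x|).mul_left C) fun m => ?_
  rw [norm_mul, norm_pow, Real.norm_eq_abs, Real.norm_eq_abs]
  calc |c m| * |x| ^ m ≤ C / m.factorial * |x| ^ m := by gcongr; exact hc m
    _ = _ := by ring

lemma summable_mul_mul_pow_pred {c : ℕ → ℝ} {C : ℝ}
    (hc : ∀ m, |c m| ≤ C / m.factorial) (x : ℝ) :
    Summable fun m : ℕ => c m * (m * x ^ (m - 1)) := by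
  rw [← summable_nat_add_iff 1]
  refine Summable.of_norm_bounded ((Real.summable_pow_div_factorial |x|).mul_left C) fun m => ?_
  rw [Real.norm_eq_abs, abs_mul, abs_mul, abs_pow, Nat.abs_cast, Nat.add_sub_cancel]
  calc |c (m + 1)| * (((m + 1 : ℕ) : ℝ) * |x| ^ m)
      ≤ C / (m + 1).factorial * (((m + 1 : ℕ) : ℝ) * |x| ^ m) := by gcongr; exact hc _
    _ = _ := by rw [Nat.factorial_succ]; push_cast; field_simp

lemma hasDerivAt_tsum_mul_pow {c : ℕ → ℝ} {C : ℝ}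
    (hc : ∀ m, |c m| ≤ C / m.factorial) (x : ℝ) :
    HasDerivAt (fun y => ∑' m, c m * y ^ m) (∑' m : ℕ, c m * (m * x ^ (m - 1))) x := by
  have hC : ∀ m, |(|c m|)| ≤ C / m.factorial := by simpa using hc
  have hx : x ∈ Metric.ball (0 : ℝ) (|x| + 1) := by simp
  refine hasDerivAt_tsum_of_isPreconnected (summable_mul_mul_pow_pred hC (|x| + 1))
    Metric.isOpen_ball (convex_ball _ _).isPreconnected
    (fun m y _ => (hasDerivAt_pow m y).const_mul (c m)) (fun m y hy => ?_) hx
    (summable_mul_pow_of_abs_le_div_factorial hc x) hx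
  rw [Real.norm_eq_abs, abs_mul, abs_mul, abs_pow, Nat.abs_cast]
  have : |y| ≤ |x| + 1 := by
    rw [mem_ball_zero_iff, Real.norm_eq_abs] at hy
    exact hy.le
  gcongr

/-- The coefficients of the power series of the modified Struve function. -/
def struveCoeff (α : ℝ) (m : ℕ) : ℝ := 1 / (Real.Gamma (m + 3 / 2) * Real.Gamma (m + α + 3 / 2))

/-- The entire function `A` with `L_α(y) = (y / 2) ^ (α + 1) * A ((y / 2) ^ 2)`. -/
def struveSeries (α x : ℝ) : ℝ := ∑' m, struveCoeff α m * x ^ m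

lemma struveL_eq (α y : ℝ) :
    struveL α y = (y / 2) ^ (α + 1) * struveSeries α ((y / 2) ^ 2) := by
  rw [struveL, struveSeries]
  congr 1
  refine tsum_congr fun m => ?_
  rw [struveCoeff, ← pow_mul]
  ring

lemma struveCoeff_nonneg {α : ℝ} (hα : -(3 / 2) < α) (m : ℕ) : 0 ≤ struveCoeff α m := by
  have : 0 < Real.Gamma (m + 3 / 2) := Real.Gamma_pos_of_pos (by positivity)
  have : 0 < Real.Gamma (m + α + 3 / 2) :=
    Real.Gamma_pos_of_pos (by have : (0 : ℝ) ≤ m := m.cast_nonneg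
                              linarith)
  unfold struveCoeff; positivity

lemma factorial_mul_Gamma_le {x : ℝ} (hx : 1 ≤ x) (m : ℕ) :
    m.factorial * Real.Gamma x ≤ Real.Gamma (m + x) := by
  have hG : 0 < Real.Gamma x := Real.Gamma_pos_of_pos (by linarith)
  induction m with
  | zero => simp
  | succ m ih =>
    have hm : (0 : ℝ) ≤ m := m.cast_nonneg
    rw [show ((m + 1 : ℕ) : ℝ) + x = (m + x) + 1 by push_cast; ring,
      Real.Gamma_add_one (by positivity), Nat.factorial_succ]
    push_cast
    rw [mul_assoc]
    gcongr

/-- One of the two Gamma factors already supplies `m!`; the other only has to stay bounded below,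
for which `α + 3/2 ≥ 1` suffices. -/
lemma abs_struveCoeff_le {α : ℝ} (hα : -(1 / 2) ≤ α) (m : ℕ) :
    |struveCoeff α m| ≤ 1 / (Real.Gamma (3 / 2) * Real.Gamma (α + 3 / 2)) / m.factorial := by
  rw [abs_of_nonneg (struveCoeff_nonneg (by linarith) m), struveCoeff, div_div]
  have h1 := factorial_mul_Gamma_le (x := 3 / 2) (by norm_num) m
  have h2 := factorial_mul_Gamma_le (x := α + 3 / 2) (by linarith) m
  have g1 : 0 < Real.Gamma (3 / 2) := Real.Gamma_pos_of_pos (by norm_num)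
  have g2 : 0 < Real.Gamma (α + 3 / 2) := Real.Gamma_pos_of_pos (by linarith)
  have hf : (1 : ℝ) ≤ m.factorial := by exact_mod_cast m.factorial_pos
  rw [← add_assoc] at h2
  apply one_div_le_one_div_of_le (by positivity)
  calc Real.Gamma (3 / 2) * Real.Gamma (α + 3 / 2) * m.factorial
      = (m.factorial * Real.Gamma (3 / 2)) * (1 * Real.Gamma (α + 3 / 2)) := by ring
    _ ≤ Real.Gamma (m + 3 / 2) * (m.factorial * Real.Gamma (α + 3 / 2)) := by gcongr
    _ ≤ _ := by gcongr

/-- The derivative of `struveSeries`, see `hasDerivAt_struveSeries`. -/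
def struveSeriesDeriv (α x : ℝ) : ℝ := ∑' m : ℕ, struveCoeff α m * (m * x ^ (m - 1))

lemma hasDerivAt_struveSeries {α : ℝ} (hα : -(1 / 2) ≤ α) (x : ℝ) :
    HasDerivAt (struveSeries α) (struveSeriesDeriv α x) x :=
  hasDerivAt_tsum_mul_pow (abs_struveCoeff_le hα) x

/-- The Euler operator `b + x d/dx` multiplies the `m`-th coefficient by `m + b`. With `b = 1/2` or
`b = α + 1/2` that factor cancels against one of the two Gamma functions, which gives the two
recurrences below. -/
lemma mul_struveSeries_add_mul_deriv {α : ℝ} (hα : -(1 / 2) ≤ α) (b x : ℝ) :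
    HasSum (fun m : ℕ => (m + b) * struveCoeff α m * x ^ m)
      (b * struveSeries α x + x * struveSeriesDeriv α x) := by
  have h1 := (summable_mul_pow_of_abs_le_div_factorial (abs_struveCoeff_le hα) x).hasSum.mul_left b
  have h2 := (summable_mul_mul_pow_pred (abs_struveCoeff_le hα) x).hasSum.mul_left x
  refine (h1.add h2).congr_fun fun m => ?_
  rcases m with _ | m
  · simp
  · simp only [Nat.add_sub_cancel]
    ring

/-- After the cancellation the terms with `m ≥ 1` are a shifted series of order `α + 1`. The
leftover `m = 0` term is the only inhomogeneity, and it eventually becomes the normalizing constant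
of the variance gamma density. -/
lemma half_mul_struveSeries_add {α : ℝ} (hα : -(1 / 2) ≤ α) (x : ℝ) :
    1 / 2 * struveSeries α x + x * struveSeriesDeriv α x =
      1 / (√Real.pi * Real.Gamma (α + 3 / 2)) + x * struveSeries (α + 1) x := by
  have h := mul_struveSeries_add_mul_deriv hα (1 / 2) x
  rw [← h.tsum_eq, h.summable.tsum_eq_zero_add, struveSeries, ← tsum_mul_left]
  congr 1
  · have : Real.Gamma (3 / 2) = 1 / 2 * √Real.pi := by
      rw [show (3 / 2 : ℝ) = 1 / 2 + 1 by norm_num, Real.Gamma_add_one (by norm_num),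
        Real.Gamma_one_half_eq]
    simp only [struveCoeff, Nat.cast_zero, zero_add, this, pow_zero]
    field_simp
  · refine tsum_congr fun m => ?_
    have hm : (0 : ℝ) ≤ m := m.cast_nonneg
    simp only [struveCoeff]
    rw [show ((m + 1 : ℕ) : ℝ) + 3 / 2 = (m + 3 / 2) + 1 by push_cast; ring,
      Real.Gamma_add_one (by positivity),
      show ((m + 1 : ℕ) : ℝ) + α + 3 / 2 = m + (α + 1) + 3 / 2 by push_cast; ring]
    push_cast
    rw [show (m : ℝ) + 1 + 1 / 2 = m + 3 / 2 by ring]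
    have : (m : ℝ) + 3 / 2 ≠ 0 := by positivity
    field_simp
    ring

lemma mul_struveSeries_add {α : ℝ} (hα : 1 / 2 ≤ α) (x : ℝ) :
    (α + 1 / 2) * struveSeries α x + x * struveSeriesDeriv α x = struveSeries (α - 1) x := by
  have h := mul_struveSeries_add_mul_deriv (α := α) (by linarith) (α + 1 / 2) x
  rw [← h.tsum_eq, struveSeries]
  refine tsum_congr fun m => ?_
  have hm : (0 : ℝ) ≤ m := m.cast_nonneg
  simp only [struveCoeff]
  have h0 : (m : ℝ) + (α + 1 / 2) ≠ 0 := by positivity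
  rw [show (m : ℝ) + α + 3 / 2 = (m + (α + 1 / 2)) + 1 by ring, Real.Gamma_add_one h0,
    show (m : ℝ) + (α - 1) + 3 / 2 = m + (α + 1 / 2) by ring]
  field_simp

/-- Writing `K_{ν-1}` as `K_{1-ν}` leaves the power `(w/2)^(2ν+1)` on the second product; on the
first all powers but `w/2` cancel. -/
lemma mul_besselK_mul_struveL_add {ν w : ℝ} (hw : 0 < w) :
    w / 2 * (besselK ν w * struveL (ν - 1) w + besselK (ν - 1) w * struveL ν w) =
      1 / 2 * (w / 2 * (gigIntegral ν w * struveSeries (ν - 1) ((w / 2) ^ 2)) +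
        (w / 2) ^ (2 * ν + 1) * (gigIntegral (1 - ν) w * struveSeries ν ((w / 2) ^ 2))) := by
  have hu : 0 < w / 2 := by positivity
  rw [besselK_eq_gigIntegral ν hw, ← besselK_neg_order (ν - 1), besselK_eq_gigIntegral _ hw,
    struveL_eq, struveL_eq, neg_neg, neg_sub]
  have h1 : (w / 2) ^ (-ν) * (w / 2) ^ (ν - 1 + 1) = 1 := by
    rw [← Real.rpow_add hu]; simp
  have h2 : (w / 2) * ((w / 2) ^ (ν - 1) * (w / 2) ^ (ν + 1)) = (w / 2) ^ (2 * ν + 1) := by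
    rw [← Real.rpow_add hu, mul_comm, ← Real.rpow_add_one hu.ne']
    congr 1; ring
  rw [← h2]
  linear_combination (w / 4) * gigIntegral ν w * struveSeries (ν - 1) ((w / 2) ^ 2) * h1

/-- By the recurrences for both series, all products of a Bessel and a Struve factor cancel in
pairs; only the constant of `half_mul_struveSeries_add` times `gigIntegral ν w` survives. -/
lemma hasDerivAt_besselK_struveL {ν w : ℝ} (hν : 1 / 2 ≤ ν) (hw : 0 < w) :
    HasDerivAt (fun w => 1 / 2 * (w / 2 * (gigIntegral ν w * struveSeries (ν - 1) ((w / 2) ^ 2)) +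
        (w / 2) ^ (2 * ν + 1) * (gigIntegral (1 - ν) w * struveSeries ν ((w / 2) ^ 2))))
      (gigIntegral ν w / (2 * √Real.pi * Real.Gamma (ν + 1 / 2))) w := by
  have hu : 0 < w / 2 := by positivity
  have d0 : HasDerivAt (fun w : ℝ => w / 2) (1 / 2) w := (hasDerivAt_id w).div_const 2
  have d1 : HasDerivAt (fun w : ℝ => (w / 2) ^ 2) (w / 2) w := by
    refine (d0.fun_pow 2).congr_deriv ?_
    norm_num; ring
  have d2 : HasDerivAt (fun w : ℝ => (w / 2) ^ (2 * ν + 1)) ((ν + 1 / 2) * (w / 2) ^ (2 * ν)) w := by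
    refine (d0.rpow_const (p := 2 * ν + 1) (Or.inl hu.ne')).congr_deriv ?_
    rw [add_sub_cancel_right]; ring
  have s1 := (hasDerivAt_struveSeries (α := ν - 1) (by linarith) ((w / 2) ^ 2)).comp w d1
  have s2 := (hasDerivAt_struveSeries (α := ν) (by linarith) ((w / 2) ^ 2)).comp w d1
  have g1 := hasDerivAt_gigIntegral ν hw
  have g2 := hasDerivAt_gigIntegral (1 - ν) hw
  refine (((d0.mul (g1.mul s1)).add (d2.mul (g2.mul s2))).const_mul (1 / 2)).congr_deriv ?_
  have e1 := half_mul_struveSeries_add (α := ν - 1) (by linarith) ((w / 2) ^ 2)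
  have e2 := mul_struveSeries_add hν ((w / 2) ^ 2)
  rw [show ν - 1 + 3 / 2 = ν + 1 / 2 by ring, sub_add_cancel] at e1
  -- Reflection brings the orders `-ν` and `1 - ν` back to `ν` and `ν - 1`, so that the cross terms
  -- match.
  have r1 : (w / 2) ^ (2 * ν + 1) * gigIntegral (1 - ν - 1) w = w / 2 * gigIntegral ν w := by
    rw [show 1 - ν - 1 = -ν by ring, gigIntegral_neg_order ν hw, ← mul_assoc,
      ← Real.rpow_add hu]
    norm_num
  have r2 : (w / 2) ^ (2 * ν) * gigIntegral (1 - ν) w = (w / 2) ^ 2 * gigIntegral (ν - 1) w := by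
    rw [show 1 - ν = -(ν - 1) by ring, gigIntegral_neg_order (ν - 1) hw, ← mul_assoc,
      ← Real.rpow_add hu, ← Real.rpow_natCast]
    congr 2; push_cast; ring
  have r3 : (w / 2) ^ (2 * ν + 1) = (w / 2) ^ (2 * ν) * (w / 2) := by
    rw [Real.rpow_add_one hu.ne']
  have hG : Real.Gamma (ν + 1 / 2) ≠ 0 := (Real.Gamma_pos_of_pos (by linarith)).ne'
  have hp : √Real.pi ≠ 0 := by positivity
  have e1' : gigIntegral ν w / (2 * √Real.pi * Real.Gamma (ν + 1 / 2)) =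
      1 / 2 * gigIntegral ν w * (1 / (√Real.pi * Real.Gamma (ν + 1 / 2))) := by
    field_simp
  rw [e1']
  simp only [Pi.mul_apply, Function.comp_apply]
  linear_combination 1 / 2 * gigIntegral ν w * e1 + 1 / 2 * (w / 2) ^ (2 * ν) *
      gigIntegral (1 - ν) w * e2 + 1 / 2 * gigIntegral (1 - ν) w * struveSeriesDeriv ν ((w / 2) ^ 2)
      * (w / 2) * r3 - 1 / 2 * (w / 2) * struveSeries ν ((w / 2) ^ 2) * r1 +
    1 / 2 * struveSeries (ν - 1) ((w / 2) ^ 2) * r2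

/-! ### The symmetric variance gamma distribution -/

/-- The probability density with characteristic function `(1 + t²) ^ (-(ν + 1 / 2))`. -/
def varianceGammaPDF (ν y : ℝ) : ℝ := gigIntegral ν y / (2 * √Real.pi * Real.Gamma (ν + 1 / 2))

section VarianceGamma

variable {ν : ℝ}

lemma varianceGamma_normalization_pos (hν : 0 < ν) :
    0 < 2 * √Real.pi * Real.Gamma (ν + 1 / 2) := by
  have := Real.Gamma_pos_of_pos (s := ν + 1 / 2) (by linarith)
  positivity

lemma varianceGammaPDF_nonneg (hν : 0 < ν) (y : ℝ) : 0 ≤ varianceGammaPDF ν y :=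
  div_nonneg (gigIntegral_nonneg ν y) (varianceGamma_normalization_pos hν).le

lemma varianceGammaPDF_neg (ν y : ℝ) : varianceGammaPDF ν (-y) = varianceGammaPDF ν y := by
  rw [varianceGammaPDF, gigIntegral_neg, varianceGammaPDF]

lemma varianceGammaPDF_le (hν : 0 < ν) (y : ℝ) :
    varianceGammaPDF ν y ≤ Real.Gamma ν / (2 * √Real.pi * Real.Gamma (ν + 1 / 2)) :=
  div_le_div_of_nonneg_right (gigIntegral_le_Gamma hν y) (varianceGamma_normalization_pos hν).le

lemma continuous_varianceGammaPDF (hν : 0 < ν) : Continuous (varianceGammaPDF ν) :=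
  (continuous_gigIntegral hν).div_const _

lemma integrable_varianceGammaPDF (hν : 0 < ν) : Integrable (varianceGammaPDF ν) :=
  (integrable_gigIntegral hν).div_const _

lemma integral_varianceGammaPDF (hν : 0 < ν) : ∫ y, varianceGammaPDF ν y = 1 := by
  simp only [varianceGammaPDF]
  rw [integral_div, integral_gigIntegral hν, div_self (varianceGamma_normalization_pos hν).ne']

lemma integral_varianceGammaPDF_mul_cexp (hν : 0 < ν) (t : ℝ) :
    ∫ y : ℝ, (varianceGammaPDF ν y : ℂ) * Complex.exp (t * y * Complex.I) =
      (((1 / (1 + t ^ 2)) ^ (ν + 1 / 2) : ℝ) : ℂ) := by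
  have h := integral_gigIntegral_mul_cexp hν t
  have h1 : ∀ y : ℝ, (varianceGammaPDF ν y : ℂ) * Complex.exp (t * y * Complex.I) =
      (((2 * √Real.pi * Real.Gamma (ν + 1 / 2))⁻¹ : ℝ) : ℂ) *
        ((gigIntegral ν y : ℂ) * Complex.exp (t * y * Complex.I)) := by
    intro y
    rw [varianceGammaPDF, div_eq_inv_mul, Complex.ofReal_mul]
    ring
  simp_rw [h1]
  rw [integral_const_mul, h, ← Complex.ofReal_mul, inv_mul_cancel_left₀
    (varianceGamma_normalization_pos hν).ne']

/-- The density is even with total mass 1, so the half-line has mass 1/2. This is the constant in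
the bounds for `V` and the CDF. -/
lemma intervalIntegral_varianceGammaPDF_mem_Icc (hν : 0 < ν) {w : ℝ} (hw : 0 ≤ w) :
    ∫ y in (0 : ℝ)..w, varianceGammaPDF ν y ∈ Set.Icc (0 : ℝ) (1 / 2) := by
  constructor
  · exact intervalIntegral.integral_nonneg hw fun y _ => varianceGammaPDF_nonneg hν y
  · have hi := integrable_varianceGammaPDF hν
    have h1 : ∫ y in Set.Ioi (0 : ℝ), varianceGammaPDF ν y = 1 / 2 := by
      have h := integral_comp_abs (f := varianceGammaPDF ν)
      have h2 : ∀ y, varianceGammaPDF ν |y| = varianceGammaPDF ν y := fun y => by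
        rw [varianceGammaPDF, gigIntegral_abs, varianceGammaPDF]
      simp only [h2, integral_varianceGammaPDF hν] at h
      linarith
    rw [intervalIntegral.integral_of_le hw, ← h1]
    exact setIntegral_mono_set hi.integrableOn
      (.of_forall fun y => varianceGammaPDF_nonneg hν y) Set.Ioc_subset_Ioi_self.eventuallyLE

/-- The fundamental theorem of calculus: the left side has the density as derivative and vanishes at
0. Only continuity at 0 is delicate, because `gigIntegral (1 - ν)` may blow up there. -/
lemma besselK_struveL_eq_intervalIntegral (hν : 1 / 2 ≤ ν) {w : ℝ} (hw : 0 < w) :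
    w / 2 * (besselK ν w * struveL (ν - 1) w + besselK (ν - 1) w * struveL ν w) =
      ∫ y in (0 : ℝ)..w, varianceGammaPDF ν y := by
  have hν0 : 0 < ν := by linarith
  rw [mul_besselK_mul_struveL_add hw]
  set Ψ : ℝ → ℝ := fun w =>
    1 / 2 * (w / 2 * (gigIntegral ν w * struveSeries (ν - 1) ((w / 2) ^ 2)) +
        (w / 2) ^ (2 * ν + 1) * (gigIntegral (1 - ν) w * struveSeries ν ((w / 2) ^ 2))) with hΨ
  have hs : ∀ α : ℝ, -(1 / 2) ≤ α → Continuous (struveSeries α) := fun α hα =>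
    continuous_iff_continuousAt.2 fun x => (hasDerivAt_struveSeries hα x).continuousAt
  have hg := continuous_gigIntegral hν0
  have hs1 := hs (ν - 1) (by linarith)
  have hs2 := hs ν (by linarith)
  have hΨ0 : Ψ 0 = 0 := by
    simp only [hΨ, zero_div, zero_mul, zero_add]
    rw [Real.zero_rpow (by linarith)]
    simp
  have hsnn : ∀ x, 0 ≤ x → 0 ≤ struveSeries ν x := fun x hx =>
    tsum_nonneg fun m => mul_nonneg (struveCoeff_nonneg (by linarith) m) (pow_nonneg hx m)
  -- `K_{1-ν} ≤ K_ν` because `|1 - ν| ≤ ν` for `ν ≥ 1/2`. This trades the possibly singular integral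
  -- for the continuous `gigIntegral ν`, with a factor `(y/2)²` that vanishes at 0.
  have hbound : ∀ y ∈ Set.Ioi (0 : ℝ),
      (y / 2) ^ (2 * ν + 1) * gigIntegral (1 - ν) y ≤ (y / 2) ^ 2 * gigIntegral ν y := by
    intro y hy
    have hy : 0 < y := hy
    have hu : 0 < y / 2 := by positivity
    have h := besselK_le_of_abs_le (α := 1 - ν) (β := ν) hy (by
      rw [abs_le, abs_of_pos hν0]; constructor <;> linarith)
    rw [besselK_eq_gigIntegral _ hy, besselK_eq_gigIntegral _ hy] at h
    have e1 : (y / 2) ^ (2 * ν + 1) = (y / 2) ^ (ν + 2) * (y / 2) ^ (-(1 - ν)) := by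
      rw [← Real.rpow_add hu]; congr 1; ring
    have e2 : (y / 2) ^ 2 = (y / 2) ^ (ν + 2) * (y / 2) ^ (-ν) := by
      rw [← Real.rpow_add hu, ← Real.rpow_natCast]; congr 1; push_cast; ring
    rw [e1, e2, mul_assoc, mul_assoc]
    exact mul_le_mul_of_nonneg_left (by linarith) (Real.rpow_nonneg hu.le _)
  have hc0 : ContinuousWithinAt Ψ (Set.Ioi 0) 0 := by
    rw [ContinuousWithinAt, hΨ0]
    have hup : Continuous fun w : ℝ => 1 / 2 * (w / 2 * (gigIntegral ν w *
        struveSeries (ν - 1) ((w / 2) ^ 2)) +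
        (w / 2) ^ 2 * gigIntegral ν w * struveSeries ν ((w / 2) ^ 2)) := by fun_prop
    have hup0 := hup.continuousWithinAt (s := Set.Ioi 0) (x := 0)
    have hlo : Continuous fun w : ℝ => 1 / 2 * (w / 2 * (gigIntegral ν w *
        struveSeries (ν - 1) ((w / 2) ^ 2))) := by fun_prop
    have hlo0 := hlo.continuousWithinAt (s := Set.Ioi 0) (x := 0)
    simp only [ContinuousWithinAt] at hup0 hlo0
    refine tendsto_of_tendsto_of_tendsto_of_le_of_le' (by simpa using hlo0) (by simpa using hup0)
      ?_ ?_
    · filter_upwards [self_mem_nhdsWithin] with y hy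
      have hy : 0 < y := hy
      have := gigIntegral_nonneg (1 - ν) y
      have := hsnn ((y / 2) ^ 2) (by positivity)
      simp only [hΨ]
      have : 0 ≤ (y / 2) ^ (2 * ν + 1) * (gigIntegral (1 - ν) y * struveSeries ν ((y / 2) ^ 2)) := by
        positivity
      linarith
    · filter_upwards [self_mem_nhdsWithin] with y hy
      have := mul_le_mul_of_nonneg_right (hbound y hy) (hsnn ((y / 2) ^ 2) (by positivity))
      simp only [hΨ]
      linarith
  have hcont : ContinuousOn Ψ (Set.Icc 0 w) := by
    intro y hy
    rcases hy.1.eq_or_lt with rfl | hy0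
    · refine ContinuousWithinAt.mono ?_ (Set.Icc_subset_Ici_self)
      rw [← Set.Ioi_insert]
      exact hc0.insert
    · exact (hasDerivAt_besselK_struveL hν hy0).continuousAt.continuousWithinAt
  have h := intervalIntegral.integral_eq_sub_of_hasDerivAt_of_le (f' := varianceGammaPDF ν) hw.le
    hcont (fun y hy => hasDerivAt_besselK_struveL hν hy.1)
    ((continuous_varianceGammaPDF hν0).intervalIntegrable _ _)
  rw [hΨ0, sub_zero] at h
  exact h.symm

end VarianceGamma

/-- The order `(r - 1) / 2 + k` of the Bessel functions in `funU` and `funD`. -/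
def besselOrder (r k : ℕ) : ℝ := ((r : ℝ) - 1) / 2 + k

/-! ### The functions `U_k` and `D_k` as variance gamma densities and their integrals. -/

lemma half_le_besselOrder {r : ℕ} (hr : 2 ≤ r) (k : ℕ) : 1 / 2 ≤ besselOrder r k := by
  have : (2 : ℝ) ≤ r := by exact_mod_cast hr
  have : (0 : ℝ) ≤ k := k.cast_nonneg
  unfold besselOrder; linarith

lemma besselOrder_pos {r : ℕ} (hr : 2 ≤ r) (k : ℕ) : 0 < besselOrder r k := by
  linarith [half_le_besselOrder hr k]

lemma besselOrder_add_half (r k : ℕ) : besselOrder r k + 1 / 2 = (r : ℝ) / 2 + k := by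
  unfold besselOrder; ring

lemma funU_abs_eq {r : ℕ} (hr : 2 ≤ r) (k : ℕ) (y : ℝ) :
    funU r k |y| = √Real.pi * varianceGammaPDF (besselOrder r k) y := by
  have hp : √Real.pi ≠ 0 := by positivity
  have hG : 0 < Real.Gamma (besselOrder r k + 1 / 2) :=
    Real.Gamma_pos_of_pos (by linarith [besselOrder_pos hr k])
  rw [funU, varianceGammaPDF, ← besselOrder_add_half, ← besselOrder]
  split_ifs with h
  · rw [abs_eq_zero.1 h, gigIntegral_zero (besselOrder_pos hr k)]
    field_simp
  · have hy : 0 < |y| := lt_of_le_of_ne (abs_nonneg y) (Ne.symm h)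
    have hu : 0 < (|y| / 2) ^ besselOrder r k := by positivity
    rw [besselK_eq_gigIntegral _ hy, gigIntegral_abs, Real.rpow_neg (by positivity)]
    field_simp

lemma funD_eq_intervalIntegral {r : ℕ} (hr : 2 ≤ r) {ρ : ℕ → ℝ} (hρ : 0 < ρ (r - 1)) (k : ℕ)
    {z : ℝ} (hz : 0 ≤ z) :
    funD r ρ k z = ∫ y in (0 : ℝ)..(z / ρ (r - 1)), varianceGammaPDF (besselOrder r k) y := by
  rcases hz.eq_or_lt with rfl | hz
  · simp [funD]
  rw [← besselK_struveL_eq_intervalIntegral (half_le_besselOrder hr k) (by positivity), funD,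
    ← besselOrder, show ((r : ℝ) - 3) / 2 + k = besselOrder r k - 1 by unfold besselOrder; ring]
  congr 1
  field_simp

lemma funD_mem_Icc {r : ℕ} (hr : 2 ≤ r) {ρ : ℕ → ℝ} (hρ : 0 < ρ (r - 1)) (k : ℕ)
    {z : ℝ} (hz : 0 ≤ z) : funD r ρ k z ∈ Set.Icc (0 : ℝ) (1 / 2) := by
  rw [funD_eq_intervalIntegral hr hρ k hz]
  exact intervalIntegral_varianceGammaPDF_mem_Icc (besselOrder_pos hr k) (by positivity)

/-- Each step multiplies the ratio by `(ν + k)/(ν + k + 1/2) < 1`. Hence the maximum of the `n`-th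
density also bounds every later one. -/
lemma antitone_Gamma_div_Gamma_add_half {ν : ℝ} (hν : 0 < ν) :
    Antitone fun k : ℕ => Real.Gamma (ν + k) / Real.Gamma (ν + k + 1 / 2) := by
  refine antitone_nat_of_succ_le fun k => ?_
  have hk : 0 < ν + k := by positivity
  have h1 := Real.Gamma_pos_of_pos hk
  have h2 := Real.Gamma_pos_of_pos (show 0 < ν + k + 1 / 2 by positivity)
  rw [show ν + ((k + 1 : ℕ) : ℝ) = ν + k + 1 by push_cast; ring, Real.Gamma_add_one hk.ne',
    show ν + (k : ℝ) + 1 + 1 / 2 = ν + k + 1 / 2 + 1 by ring, Real.Gamma_add_one (by positivity),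
    div_le_div_iff₀ (by positivity) h2]
  nlinarith [mul_pos h1 h2]

/-! ### The binomial series with exponent `-1/2` and the weights of the mixture -/

/-- The generalized binomial coefficient is the rising factorial of 1/2 over `n!`, and that rising
factorial is `(2n)!/(n! 4^n)`. -/
lemma Ring_choose_half_add (n : ℕ) :
    Ring.choose ((1 / 2 : ℝ) + n - 1) n =
      ((2 * n).factorial : ℝ) / ((n.factorial : ℝ) ^ 2 * 4 ^ n) := by
  have h0 : Ring.choose ((1 / 2 : ℝ) + n - 1) n = Ring.multichoose (1 / 2 : ℝ) n := by
    rw [Ring.choose]; congr 1; ring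
  have h1 := Ring.factorial_nsmul_multichoose_eq_ascPochhammer (1 / 2 : ℝ) n
  have h2 : ∀ n : ℕ, (ascPochhammer ℝ n).eval (1 / 2 : ℝ) =
      ((2 * n).factorial : ℝ) / (n.factorial * 4 ^ n) := by
    intro n
    induction n with
    | zero => simp
    | succ n ih =>
      rw [ascPochhammer_succ_eval, ih, show 2 * (n + 1) = 2 * n + 1 + 1 by ring,
        Nat.factorial_succ, Nat.factorial_succ, Nat.factorial_succ]
      push_cast
      field_simp
      ring
  rw [Polynomial.ascPochhammer_smeval_eq_eval, h2, nsmul_eq_mul] at h1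
  rw [h0]
  have : (n.factorial : ℝ) ≠ 0 := by positivity
  field_simp at h1 ⊢
  linear_combination h1

lemma hasSum_binomial_neg_half {x : ℝ} (hx : |x| < 1) :
    HasSum (fun k : ℕ => ((2 * k).factorial : ℝ) / ((k.factorial : ℝ) ^ 2 * 4 ^ k) * x ^ k)
      (1 / (1 - x) ^ (1 / 2 : ℝ)) := by
  have h := (Real.one_div_one_sub_rpow_hasFPowerSeriesOnBall_zero (1 / 2)).hasSum (y := x)
    (by simpa [enorm_eq_nnnorm] using! hx)
  simp only [FormalMultilinearSeries.ofScalars_apply_eq, Ring_choose_half_add, zero_add,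
    smul_eq_mul] at h
  exact h

lemma hasSum_pi_prod {n : ℕ} {f : Fin n → ℕ → ℝ} {s : Fin n → ℝ} (h0 : ∀ i k, 0 ≤ f i k)
    (h : ∀ i, HasSum (f i) (s i)) :
    HasSum (fun κ : Fin n → ℕ => ∏ i, f i (κ i)) (∏ i, s i) := by
  induction n with
  | zero => simp [hasSum_unique]
  | succ n ih =>
    have ih' := ih (f := fun i => f i.succ) (s := fun i => s i.succ) (fun i => h0 i.succ)
      (fun i => h i.succ)
    rw [← (Fin.consEquiv fun _ => ℕ).hasSum_iff, Fin.prod_univ_succ]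
    have hs : Summable fun q : ℕ × (Fin n → ℕ) => f 0 q.1 * ∏ i, f (Fin.succ i) (q.2 i) :=
      Summable.mul_of_nonneg (f := f 0) (g := fun κ : Fin n → ℕ => ∏ i, f (Fin.succ i) (κ i))
        (h 0).summable ih'.summable (fun k => h0 0 k)
        (fun κ => Finset.prod_nonneg fun i _ => h0 _ _)
    have := (h 0).mul ih' hs
    refine this.congr_fun fun q => ?_
    simp [Fin.prod_univ_succ, Fin.consEquiv]

section Weights

variable (r : ℕ) (ρ : ℕ → ℝ)

/-- The weight of the multi-index `(k_1, ..., k_{r-1})` in the mixture. -/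
def multiWeight (κ : Fin (r - 1) → ℕ) : ℝ :=
  ∏ i : Fin (r - 1), ρ (r - 1) / ρ i * coeffFactor r ρ i (κ i)

/-- The weight `Π δ_k` of the `k`-th variance gamma distribution in the mixture. -/
def mixWeight (k : ℕ) : ℝ := corrProd r ρ * delta r ρ k

lemma mixWeight_eq_sum (k : ℕ) :
    mixWeight r ρ k = ∑ κ ∈ Finset.piAntidiag Finset.univ k, multiWeight r ρ κ := by
  rw [mixWeight, corrProd, delta, Finset.mul_sum]
  exact Finset.sum_congr rfl fun κ _ => Finset.prod_mul_distrib.symm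

variable {r ρ} (hr : 2 ≤ r) (hpos : 0 < ρ (r - 1)) (hanti : Antitone ρ)
include hpos hanti

lemma corr_pos (i : Fin (r - 1)) : 0 < ρ i := hpos.trans_le (hanti i.2.le)

/-- The role of the ordering: membership in `[0, 1)` makes the weights nonnegative and the binomial
series convergent for all `y ≤ 1`, including `y = 1`. -/
lemma one_sub_sq_div_sq_mem (i : Fin (r - 1)) :
    1 - ρ (r - 1) ^ 2 / ρ i ^ 2 ∈ Set.Ico (0 : ℝ) 1 := by
  have h1 := corr_pos hpos hanti i
  have h2 : ρ (r - 1) ≤ ρ i := hanti i.2.le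
  constructor
  · rw [sub_nonneg, div_le_one (by positivity)]
    gcongr
  · rw [sub_lt_self_iff]
    positivity

lemma coeffFactor_nonneg (i : Fin (r - 1)) (k : ℕ) : 0 ≤ coeffFactor r ρ i k := by
  have := (one_sub_sq_div_sq_mem hpos hanti i).1
  unfold coeffFactor
  positivity

lemma multiWeight_nonneg (κ : Fin (r - 1) → ℕ) : 0 ≤ multiWeight r ρ κ :=
  Finset.prod_nonneg fun i _ => mul_nonneg (div_pos hpos (corr_pos hpos hanti i)).le
    (coeffFactor_nonneg hpos hanti i _)

lemma mixWeight_nonneg (k : ℕ) : 0 ≤ mixWeight r ρ k := by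
  rw [mixWeight_eq_sum]
  exact Finset.sum_nonneg fun κ _ => multiWeight_nonneg hpos hanti κ

/-- The generating function of the weights. -/
lemma hasSum_multiWeight_mul_pow {y : ℝ} (hy0 : 0 ≤ y) (hy1 : y ≤ 1) :
    HasSum (fun κ : Fin (r - 1) → ℕ => multiWeight r ρ κ * y ^ (∑ i, κ i))
      (∏ i : Fin (r - 1), ρ (r - 1) / ρ i *
        (1 / (1 - (1 - ρ (r - 1) ^ 2 / ρ i ^ 2) * y) ^ (1 / 2 : ℝ))) := by
  have h := hasSum_pi_prod
    (f := fun (i : Fin (r - 1)) k => ρ (r - 1) / ρ i * (coeffFactor r ρ i k * y ^ k))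
    (s := fun i : Fin (r - 1) => ρ (r - 1) / ρ i *
        (1 / (1 - (1 - ρ (r - 1) ^ 2 / ρ i ^ 2) * y) ^ (1 / 2 : ℝ)))
    (fun i k => mul_nonneg (div_pos hpos (corr_pos hpos hanti i)).le
      (mul_nonneg (coeffFactor_nonneg hpos hanti i _) (pow_nonneg hy0 _))) (fun i => ?_)
  · refine h.congr_fun fun κ => ?_
    rw [multiWeight, ← Finset.prod_pow_eq_pow_sum, ← Finset.prod_mul_distrib]
    exact Finset.prod_congr rfl fun i _ => by ring
  · have ha := one_sub_sq_div_sq_mem hpos hanti i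
    refine HasSum.mul_left _ ?_
    have hx : |(1 - ρ (r - 1) ^ 2 / ρ i ^ 2) * y| < 1 := by
      rw [abs_of_nonneg (mul_nonneg ha.1 hy0)]
      exact (mul_le_of_le_one_right ha.1 hy1).trans_lt ha.2
    refine (hasSum_binomial_neg_half hx).congr_fun fun k => ?_
    rw [coeffFactor, mul_pow, mul_assoc]

/-- At `y = 1` the `i`-th binomial series sums to `ρ_i/ρ_r`, which cancels the prefactor. -/
lemma hasSum_multiWeight : HasSum (multiWeight r ρ) 1 := by
  have h := hasSum_multiWeight_mul_pow hpos hanti zero_le_one le_rfl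
  simp only [one_pow, mul_one, sub_sub_cancel] at h
  convert h using 1
  symm
  refine Finset.prod_eq_one fun i _ => ?_
  have h1 := corr_pos hpos hanti i
  rw [← div_pow, ← Real.sqrt_eq_rpow, Real.sqrt_sq (by positivity)]
  field_simp

omit hpos hanti in
-- Regroups a multiple series by total degree; the fibres are the finite sets `piAntidiag`.
lemma HasSum.fiber_sum {n : ℕ} {g : (Fin n → ℕ) → ℝ} {a : ℝ} (h : HasSum g a) :
    HasSum (fun k => ∑ κ ∈ Finset.piAntidiag Finset.univ k, g κ) a := by
  rw [← (Equiv.sigmaFiberEquiv fun κ : Fin n → ℕ => ∑ i, κ i).hasSum_iff] at h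
  refine h.sigma fun k => ?_
  have h2 := Finset.hasSum (Finset.piAntidiag (Finset.univ : Finset (Fin n)) k) g
  have h3 := (Equiv.subtypeEquivRight (p := fun κ : Fin n → ℕ => ∑ i, κ i = k)
    (q := fun κ => κ ∈ Finset.piAntidiag (Finset.univ : Finset (Fin n)) k)
    (fun κ => by simp)).hasSum_iff.2 h2
  exact h3

lemma summable_multiWeight_mul {F : ℕ → ℝ} {B : ℝ} (hF : ∀ k, |F k| ≤ B) :
    Summable fun κ : Fin (r - 1) → ℕ => multiWeight r ρ κ * F (∑ i, κ i) := by
  refine Summable.of_norm_bounded ((hasSum_multiWeight hpos hanti).summable.mul_right B) fun κ => ?_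
  rw [norm_mul, Real.norm_of_nonneg (multiWeight_nonneg hpos hanti κ)]
  exact mul_le_mul_of_nonneg_left (hF _) (multiWeight_nonneg hpos hanti κ)

omit hpos hanti in
lemma hasSum_mixWeight_mul {F : ℕ → ℝ} {a : ℝ}
    (h : HasSum (fun κ : Fin (r - 1) → ℕ => multiWeight r ρ κ * F (∑ i, κ i)) a) :
    HasSum (fun k => mixWeight r ρ k * F k) a := by
  refine (HasSum.fiber_sum h).congr_fun fun k => ?_
  rw [mixWeight_eq_sum, Finset.sum_mul]
  refine Finset.sum_congr rfl fun κ hκ => ?_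
  rw [(Finset.mem_piAntidiag.1 hκ).1]

lemma hasSum_mixWeight : HasSum (mixWeight r ρ) 1 := by
  have := hasSum_mixWeight_mul (r := r) (ρ := ρ) (F := fun _ => 1) (a := 1)
    (by simpa using hasSum_multiWeight hpos hanti)
  simpa using this

lemma remainder_eq_tsum (n : ℕ) : remainder r ρ n = ∑' k, mixWeight r ρ (k + (n + 1)) := by
  have h := hasSum_mixWeight hpos hanti
  have := h.summable.sum_add_tsum_nat_add (n + 1)
  rw [h.tsum_eq] at this
  rw [remainder, Finset.mul_sum]
  simp only [mixWeight] at this ⊢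
  linarith

lemma summable_mixWeight_mul {F : ℕ → ℝ} {B : ℝ} (hF : ∀ k, |F k| ≤ B) :
    Summable fun k => mixWeight r ρ k * F k :=
  (hasSum_mixWeight_mul (summable_multiWeight_mul hpos hanti hF).hasSum).summable

/-- The common source of the density and `V` bounds: a tail of nonnegative weights times bounded
values. The bound on `F` is asked only beyond `n`, which lets the density constant depend on `n`. -/
lemma abs_tsum_sub_sum_le {F : ℕ → ℝ} {B : ℝ} (n : ℕ)
    (hs : Summable fun k => mixWeight r ρ k * F k) (hF : ∀ k, n < k → |F k| ≤ B) :
    |∑' k, mixWeight r ρ k * F k - ∑ k ∈ Finset.range (n + 1), mixWeight r ρ k * F k| ≤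
      B * remainder r ρ n := by
  rw [← hs.sum_add_tsum_nat_add (n + 1), add_sub_cancel_left, remainder_eq_tsum hpos hanti,
    ← tsum_mul_left, ← Real.norm_eq_abs]
  have hw := (summable_nat_add_iff (n + 1)).2 (hasSum_mixWeight hpos hanti).summable
  refine tsum_of_norm_bounded (hw.mul_left B).hasSum fun k => ?_
  have h0 := mixWeight_nonneg hpos hanti (k + (n + 1))
  rw [norm_mul, Real.norm_of_nonneg h0, mul_comm]
  exact mul_le_mul_of_nonneg_right (hF _ (by omega)) h0

include hr in
-- With `c = 1 + (ρ_r t)²`, `1 - (1 - ρ_r²/ρ_i²)/c = (ρ_r/ρ_i)² (1 + (ρ_i t)²)/c`. The factor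
-- `c^(-r/2)` supplies one `1/√c` for each of the `r - 1` series, cancelling their `√c`, and one
-- more that is the factor `i = r`.
lemma prod_mixture_factor_mul (t : ℝ) :
    (∏ i : Fin (r - 1), ρ (r - 1) / ρ i * (1 / (1 - (1 - ρ (r - 1) ^ 2 / ρ i ^ 2) *
      (1 / (1 + (ρ (r - 1) * t) ^ 2))) ^ (1 / 2 : ℝ))) *
      (1 / (1 + (ρ (r - 1) * t) ^ 2)) ^ ((r : ℝ) / 2) =
    ∏ i ∈ Finset.range r, (1 / √(1 + (ρ i * t) ^ 2)) := by
  have hi := corr_pos hpos hanti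
  have hprod : ∏ i ∈ Finset.range r, (1 / √(1 + (ρ i * t) ^ 2)) =
      (∏ i : Fin (r - 1), (1 / √(1 + (ρ i * t) ^ 2))) * (1 / √(1 + (ρ (r - 1) * t) ^ 2)) := by
    rw [← Finset.prod_range fun i => 1 / √(1 + (ρ i * t) ^ 2),
      ← Finset.prod_range_succ fun i => 1 / √(1 + (ρ i * t) ^ 2), Nat.sub_add_cancel (by omega)]
  rw [hprod]
  generalize ρ (r - 1) = σ at hpos ⊢
  set c := 1 + (σ * t) ^ 2 with hc
  have hc0 : 0 < c := by positivity
  have hsplit : (1 / c) ^ ((r : ℝ) / 2) = (∏ _i : Fin (r - 1), (1 / √c)) * (1 / √c) := by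
    rw [Finset.prod_const, Finset.card_univ, Fintype.card_fin, ← pow_succ, Real.sqrt_eq_rpow,
      one_div, one_div, ← Real.inv_rpow hc0.le, ← Real.rpow_mul_natCast (by positivity),
      Nat.sub_add_cancel (by omega)]
    congr 1; ring
  rw [hsplit, ← mul_assoc, ← Finset.prod_mul_distrib]
  congr 1
  refine Finset.prod_congr rfl fun i _ => ?_
  have hi := hi i
  have e : 1 - (1 - σ ^ 2 / ρ i ^ 2) * (1 / c) = (σ / ρ i) ^ 2 * (1 + (ρ i * t) ^ 2) / c := by
    rw [hc] at hc0 ⊢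
    field_simp
    ring
  rw [e, ← Real.sqrt_eq_rpow, Real.sqrt_div' _ hc0.le, Real.sqrt_mul (by positivity),
    Real.sqrt_sq (by positivity)]
  have : 0 < √c := by positivity
  have : 0 < √(1 + (ρ i * t) ^ 2) := by positivity
  field_simp

include hr in
/-- The characteristic function of the mixture. -/
lemma hasSum_mixWeight_charFun (t : ℝ) :
    HasSum (fun k => mixWeight r ρ k *
        (1 / (1 + (ρ (r - 1) * t) ^ 2)) ^ (besselOrder r k + 1 / 2))
      (∏ i ∈ Finset.range r, (1 / √(1 + (ρ i * t) ^ 2))) := by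
  have hc0 : 0 < 1 + (ρ (r - 1) * t) ^ 2 := by positivity
  have hy0 : 0 < 1 / (1 + (ρ (r - 1) * t) ^ 2) := by positivity
  have hy1 : 1 / (1 + (ρ (r - 1) * t) ^ 2) ≤ 1 := by
    rw [div_le_one hc0]; nlinarith [sq_nonneg (ρ (r - 1) * t)]
  have h1 := hasSum_multiWeight_mul_pow hpos hanti hy0.le hy1
  have h2 : HasSum (fun k => mixWeight r ρ k * (1 / (1 + (ρ (r - 1) * t) ^ 2)) ^ k) _ :=
    hasSum_mixWeight_mul (F := fun k => (1 / (1 + (ρ (r - 1) * t) ^ 2)) ^ k) h1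
  have h3 := h2.mul_right ((1 / (1 + (ρ (r - 1) * t) ^ 2)) ^ ((r : ℝ) / 2))
  rw [← prod_mixture_factor_mul hr hpos hanti t]
  refine h3.congr_fun fun k => ?_
  rw [besselOrder_add_half, add_comm ((r : ℝ) / 2), Real.rpow_add hy0, Real.rpow_natCast, mul_assoc]

end Weights

/-! ### The mixture of variance gamma distributions -/

/-- The normalized density of the mixture of variance gamma distributions. -/
def mixPDF (r : ℕ) (ρ : ℕ → ℝ) (y : ℝ) : ℝ :=
  ∑' k, mixWeight r ρ k * varianceGammaPDF (besselOrder r k) y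

/-- The density of `I + ρ_r Z` where `Z` has density `mixPDF r ρ`. -/
def infoDensityPDF (r : ℕ) (ρ : ℕ → ℝ) (I x : ℝ) : ℝ :=
  mixPDF r ρ ((x - I) / ρ (r - 1)) / ρ (r - 1)

/-- The maximum of the `n`-th variance gamma density. -/
def varianceGammaBound (r n : ℕ) : ℝ :=
  Real.Gamma (besselOrder r n) / (2 * √Real.pi * Real.Gamma (besselOrder r n + 1 / 2))

lemma antitone_varianceGammaBound {r : ℕ} (hr : 2 ≤ r) : Antitone (varianceGammaBound r) := by
  have h2 : (2 : ℝ) ≤ r := by exact_mod_cast hr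
  have h := antitone_Gamma_div_Gamma_add_half (ν := ((r : ℝ) - 1) / 2) (by linarith)
  intro m n hmn
  have := h hmn
  simp only [varianceGammaBound, besselOrder] at this ⊢
  have e : ∀ a b : ℝ, a / (2 * √Real.pi * b) = a / b / (2 * √Real.pi) := fun a b => by
    rw [div_div, mul_comm b]
  rw [e, e]
  exact div_le_div_of_nonneg_right this (by positivity)

lemma abs_varianceGammaPDF_besselOrder_le {r : ℕ} (hr : 2 ≤ r) {m n : ℕ} (hmn : m ≤ n) (y : ℝ) :
    |varianceGammaPDF (besselOrder r n) y| ≤ varianceGammaBound r m := by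
  rw [abs_of_nonneg (varianceGammaPDF_nonneg (besselOrder_pos hr n) y)]
  exact (varianceGammaPDF_le (besselOrder_pos hr n) y).trans (antitone_varianceGammaBound hr hmn)

section Mixture

variable {r : ℕ} {ρ : ℕ → ℝ} (hr : 2 ≤ r) (hpos : 0 < ρ (r - 1)) (hanti : Antitone ρ)
include hr hpos hanti

lemma summable_mixPDF (y : ℝ) :
    Summable fun k => mixWeight r ρ k * varianceGammaPDF (besselOrder r k) y :=
  summable_mixWeight_mul hpos hanti fun k =>
    abs_varianceGammaPDF_besselOrder_le hr (Nat.zero_le k) y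

lemma continuous_mixPDF : Continuous (mixPDF r ρ) := by
  refine continuous_tsum (fun k => (continuous_varianceGammaPDF (besselOrder_pos hr k)).const_mul _)
    ((hasSum_mixWeight hpos hanti).summable.mul_right (varianceGammaBound r 0)) fun k y => ?_
  rw [norm_mul, Real.norm_of_nonneg (mixWeight_nonneg hpos hanti k)]
  exact mul_le_mul_of_nonneg_left (abs_varianceGammaPDF_besselOrder_le hr (Nat.zero_le k) y)
    (mixWeight_nonneg hpos hanti k)

lemma mixPDF_nonneg (y : ℝ) : 0 ≤ mixPDF r ρ y :=
  tsum_nonneg fun k => mul_nonneg (mixWeight_nonneg hpos hanti k)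
    (varianceGammaPDF_nonneg (besselOrder_pos hr k) y)

omit hr hpos hanti in
lemma mixPDF_neg (y : ℝ) : mixPDF r ρ (-y) = mixPDF r ρ y := by
  simp only [mixPDF, varianceGammaPDF_neg]

/-- Sum and integral may be exchanged because the `L¹` norms of the terms are at most the summable
weights. Exponentials `g` give the characteristic function, indicators the distribution function. -/
lemma hasSum_integral_mixPDF_mul {g : ℝ → ℂ} (hg : Measurable g) (hg1 : ∀ y, ‖g y‖ ≤ 1) :
    HasSum (fun k => (mixWeight r ρ k : ℂ) *
        ∫ y, (varianceGammaPDF (besselOrder r k) y : ℂ) * g y)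
      (∫ y, (mixPDF r ρ y : ℂ) * g y) := by
  have hi : ∀ k, Integrable fun y : ℝ => (mixWeight r ρ k : ℂ) *
      ((varianceGammaPDF (besselOrder r k) y : ℂ) * g y) := fun k =>
    ((integrable_varianceGammaPDF (besselOrder_pos hr k)).ofReal.mul_bdd (c := 1)
      hg.aestronglyMeasurable (.of_forall hg1)).const_mul _
  have hn : Summable fun k => ∫ y : ℝ, ‖(mixWeight r ρ k : ℂ) *
      ((varianceGammaPDF (besselOrder r k) y : ℂ) * g y)‖ := by
    refine Summable.of_nonneg_of_le (fun k => integral_nonneg fun y => norm_nonneg _) (fun k => ?_)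
      (hasSum_mixWeight hpos hanti).summable
    have h0 := mixWeight_nonneg hpos hanti k
    calc ∫ y : ℝ, ‖(mixWeight r ρ k : ℂ) * ((varianceGammaPDF (besselOrder r k) y : ℂ) * g y)‖
        ≤ ∫ y : ℝ, mixWeight r ρ k * varianceGammaPDF (besselOrder r k) y := by
          refine integral_mono (hi k).norm
            ((integrable_varianceGammaPDF (besselOrder_pos hr k)).const_mul _) fun y => ?_
          have hv := varianceGammaPDF_nonneg (besselOrder_pos hr k) y
          simp only [norm_mul, Complex.norm_real, Real.norm_of_nonneg h0, Real.norm_of_nonneg hv]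
          exact mul_le_mul_of_nonneg_left (mul_le_of_le_one_right hv (hg1 y)) h0
      _ = mixWeight r ρ k := by
          rw [integral_const_mul, integral_varianceGammaPDF (besselOrder_pos hr k), mul_one]
  have h := hasSum_integral_of_summable_integral_norm hi hn
  simp only [integral_const_mul] at h
  convert! h using 1
  refine integral_congr_ae (.of_forall fun y => ?_)
  simp only [mixPDF, Complex.ofReal_tsum, ← tsum_mul_right, Complex.ofReal_mul, mul_assoc]

lemma integral_mixPDF_mul_cexp (t : ℝ) :
    ∫ y : ℝ, (mixPDF r ρ y : ℂ) * Complex.exp ((ρ (r - 1) * t : ℝ) * y * Complex.I) =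
      ((∏ i ∈ Finset.range r, (1 / √(1 + (ρ i * t) ^ 2)) : ℝ) : ℂ) := by
  have h := hasSum_integral_mixPDF_mul hr hpos hanti
    (g := fun y : ℝ => Complex.exp ((ρ (r - 1) * t : ℝ) * y * Complex.I)) (by fun_prop)
    (fun y => by rw [← Complex.ofReal_mul, Complex.norm_exp_ofReal_mul_I])
  simp only [integral_varianceGammaPDF_mul_cexp (besselOrder_pos hr _)] at h
  simp only [← Complex.ofReal_mul (mixWeight r ρ _)] at h
  exact h.unique ((Complex.hasSum_ofReal).2 (hasSum_mixWeight_charFun hr hpos hanti t))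

lemma integrable_mixPDF : Integrable (mixPDF r ρ) := by
  -- The Bochner integral of a non-integrable function is 0 by convention, while the characteristic
  -- function at `t = 0` gives 1.
  by_contra hni
  have h := integral_mixPDF_mul_cexp hr hpos hanti 0
  simp only [mul_zero, Complex.ofReal_zero, zero_mul, Complex.exp_zero, mul_one] at h
  rw [integral_complex_ofReal, integral_undef hni] at h
  simp at h

lemma integral_mixPDF : ∫ y, mixPDF r ρ y = 1 := by
  have h := integral_mixPDF_mul_cexp hr hpos hanti 0
  simp only [mul_zero, Complex.ofReal_zero, zero_mul, Complex.exp_zero, mul_one] at h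
  rw [integral_complex_ofReal] at h
  have := Complex.ofReal_injective h
  simpa using this

lemma hasSum_intervalIntegral_mixPDF {w : ℝ} (hw : 0 ≤ w) :
    HasSum (fun k => mixWeight r ρ k * ∫ y in (0 : ℝ)..w, varianceGammaPDF (besselOrder r k) y)
      (∫ y in (0 : ℝ)..w, mixPDF r ρ y) := by
  have h := hasSum_integral_mixPDF_mul hr hpos hanti (g := (Set.Ioc 0 w).indicator fun _ => 1)
    (measurable_const.indicator measurableSet_Ioc) (fun y => by
      by_cases hy : y ∈ Set.Ioc 0 w <;> simp [hy])
  have e : ∀ f : ℝ → ℝ, ∫ y, (f y : ℂ) * (Set.Ioc 0 w).indicator (fun _ => 1) y =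
      ((∫ y in (0 : ℝ)..w, f y : ℝ) : ℂ) := by
    intro f
    rw [intervalIntegral.integral_of_le hw, ← integral_indicator measurableSet_Ioc,
      ← integral_complex_ofReal]
    refine integral_congr_ae (.of_forall fun y => ?_)
    by_cases hy : y ∈ Set.Ioc 0 w <;> simp [hy]
  simp only [e, ← Complex.ofReal_mul] at h
  exact Complex.hasSum_ofReal.1 h

/-! ### The series for `V` and the truncation bounds. -/

lemma summable_termV {z : ℝ} (hz : 0 ≤ z) : Summable (termV r ρ z) :=
  summable_multiWeight_mul hpos hanti (F := fun k => funD r ρ k z) (B := 1 / 2) fun k => by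
    have h := funD_mem_Icc hr hpos k hz
    rw [abs_of_nonneg h.1]
    exact h.2

lemma hasSum_funV {z : ℝ} (hz : 0 ≤ z) :
    HasSum (fun k => mixWeight r ρ k * funD r ρ k z) (funV r ρ z) :=
  hasSum_mixWeight_mul (F := fun k => funD r ρ k z) (summable_termV hr hpos hanti hz).hasSum

lemma funV_eq_intervalIntegral {z : ℝ} (hz : 0 ≤ z) :
    funV r ρ z = ∫ y in (0 : ℝ)..(z / ρ (r - 1)), mixPDF r ρ y := by
  have h := hasSum_funV hr hpos hanti hz
  simp only [funD_eq_intervalIntegral hr hpos _ hz] at h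
  exact h.unique (hasSum_intervalIntegral_mixPDF hr hpos hanti (by positivity))

omit hr hpos hanti in
lemma approxV_eq (n : ℕ) (z : ℝ) :
    approxV r ρ n z = ∑ k ∈ Finset.range (n + 1), mixWeight r ρ k * funD r ρ k z := by
  rw [approxV, Finset.mul_sum]
  exact Finset.sum_congr rfl fun k _ => by rw [mixWeight, mul_assoc]

lemma abs_funV_sub_approxV_le (n : ℕ) {z : ℝ} (hz : 0 ≤ z) :
    |funV r ρ z - approxV r ρ n z| ≤ 1 / 2 * remainder r ρ n := by
  have h := hasSum_funV hr hpos hanti hz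
  rw [← h.tsum_eq, approxV_eq]
  refine abs_tsum_sub_sum_le hpos hanti n h.summable fun k _ => ?_
  have h := funD_mem_Icc hr hpos k hz
  rw [abs_of_nonneg h.1]
  exact h.2

omit hanti in
lemma approxPDF_eq (I : ℝ) (n : ℕ) (x : ℝ) :
    approxPDF r ρ I n x = (∑ k ∈ Finset.range (n + 1), mixWeight r ρ k *
      varianceGammaPDF (besselOrder r k) ((x - I) / ρ (r - 1))) / ρ (r - 1) := by
  have hp : √Real.pi ≠ 0 := by positivity
  rw [approxPDF, Finset.mul_sum, Finset.sum_div]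
  refine Finset.sum_congr rfl fun k _ => ?_
  rw [funU_abs_eq hr, mixWeight]
  field_simp

lemma abs_infoDensityPDF_sub_approxPDF_le (I : ℝ) (n : ℕ) (x : ℝ) :
    |infoDensityPDF r ρ I x - approxPDF r ρ I n x| ≤
      Real.Gamma (((r : ℝ) - 1) / 2 + n) /
        (2 * ρ (r - 1) * √Real.pi * Real.Gamma ((r : ℝ) / 2 + n)) * remainder r ρ n := by
  rw [approxPDF_eq hr hpos, infoDensityPDF, mixPDF, ← sub_div, abs_div, abs_of_pos hpos]
  have h := abs_tsum_sub_sum_le hpos hanti n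
    (summable_mixPDF hr hpos hanti ((x - I) / ρ (r - 1))) fun k hk =>
      abs_varianceGammaPDF_besselOrder_le hr hk.le ((x - I) / ρ (r - 1))
  calc _ ≤ varianceGammaBound r n * remainder r ρ n / ρ (r - 1) := by gcongr
    _ = _ := by
      rw [varianceGammaBound, besselOrder_add_half, besselOrder]
      field_simp

lemma infoDensityPDF_nonneg (I x : ℝ) : 0 ≤ infoDensityPDF r ρ I x :=
  div_nonneg (mixPDF_nonneg hr hpos hanti _) hpos.le

lemma continuous_infoDensityPDF (I : ℝ) : Continuous (infoDensityPDF r ρ I) :=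
  ((continuous_mixPDF hr hpos hanti).comp
    ((continuous_id.sub continuous_const).div_const _)).div_const _

lemma integrable_infoDensityPDF (I : ℝ) : Integrable (infoDensityPDF r ρ I) :=
  (((integrable_mixPDF hr hpos hanti).comp_div hpos.ne').comp_sub_right I).div_const _

omit hr hanti in
lemma integral_comp_sub_div {E : Type*} [NormedAddCommGroup E] [NormedSpace ℝ E] (g : ℝ → E)
    (I : ℝ) : ∫ x, g ((x - I) / ρ (r - 1)) = ρ (r - 1) • ∫ y, g y := by
  rw [integral_sub_right_eq_self (fun x => g (x / ρ (r - 1))) I, Measure.integral_comp_div,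
    abs_of_pos hpos]

/-! ### The law with density `infoDensityPDF`: characteristic function and CDF. -/

lemma isProbabilityMeasure_infoDensityPDF (I : ℝ) : IsProbabilityMeasure
    (volume.withDensity fun x => ENNReal.ofReal (infoDensityPDF r ρ I x)) := by
  constructor
  rw [withDensity_apply _ MeasurableSet.univ, Measure.restrict_univ,
    ← ofReal_integral_eq_lintegral_ofReal (integrable_infoDensityPDF hr hpos hanti I)
      (.of_forall fun x => infoDensityPDF_nonneg hr hpos hanti I x)]
  have : ∫ x, infoDensityPDF r ρ I x = 1 := by
    simp only [infoDensityPDF]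
    rw [integral_div, integral_comp_sub_div hpos (mixPDF r ρ), integral_mixPDF hr hpos hanti,
      smul_eq_mul, mul_one, div_self hpos.ne']
  rw [this, ENNReal.ofReal_one]

lemma charFun_infoDensityPDF (I t : ℝ) :
    charFun (volume.withDensity fun x => ENNReal.ofReal (infoDensityPDF r ρ I x)) t =
      Complex.exp (I * t * Complex.I) *
        ((∏ i ∈ Finset.range r, (1 / √(1 + (ρ i * t) ^ 2)) : ℝ) : ℂ) := by
  have hm := (continuous_infoDensityPDF hr hpos hanti I).measurable
  rw [charFun_apply_real, integral_withDensity_eq_integral_toReal_smul hm.ennreal_ofReal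
    (.of_forall fun x => ENNReal.ofReal_lt_top)]
  simp only [ENNReal.toReal_ofReal (infoDensityPDF_nonneg hr hpos hanti I _)]
  have e : ∀ x : ℝ, infoDensityPDF r ρ I x • Complex.exp (t * x * Complex.I) =
      (fun y : ℝ => (Complex.exp (I * t * Complex.I) / (ρ (r - 1) : ℂ)) * ((mixPDF r ρ y : ℂ) *
        Complex.exp ((ρ (r - 1) * t : ℝ) * y * Complex.I))) ((x - I) / ρ (r - 1)) := by
    intro x
    have h0 : (ρ (r - 1) : ℂ) ≠ 0 := by exact_mod_cast hpos.ne'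
    have h1 : (t : ℂ) * x * Complex.I = I * t * Complex.I +
        (ρ (r - 1) * t : ℝ) * (((x - I) / ρ (r - 1) : ℝ) : ℂ) * Complex.I := by
      push_cast
      field_simp
      ring
    rw [h1, Complex.exp_add, infoDensityPDF, Complex.real_smul, Complex.ofReal_div]
    ring
  rw [integral_congr_ae (.of_forall e), integral_comp_sub_div hpos (fun y : ℝ =>
    (Complex.exp (I * t * Complex.I) / (ρ (r - 1) : ℂ)) * ((mixPDF r ρ y : ℂ) *
        Complex.exp ((ρ (r - 1) * t : ℝ) * y * Complex.I))), integral_const_mul, integral_mixPDF_mul_cexp hr hpos hanti,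
    Complex.real_smul]
  have h0 : (ρ (r - 1) : ℂ) ≠ 0 := by exact_mod_cast hpos.ne'
  rw [← mul_assoc, mul_div_cancel₀ _ h0]

lemma cdf_infoDensityPDF (I x : ℝ) :
    cdf (volume.withDensity fun x => ENNReal.ofReal (infoDensityPDF r ρ I x)) x =
      1 / 2 + ∫ y in (0 : ℝ)..((x - I) / ρ (r - 1)), mixPDF r ρ y := by
  have := isProbabilityMeasure_infoDensityPDF hr hpos hanti I
  have hint := integrable_mixPDF hr hpos hanti
  have hhalf : ∫ y in Set.Iic (0 : ℝ), mixPDF r ρ y = 1 / 2 := by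
    have h1 := integral_comp_neg_Iic 0 (mixPDF r ρ)
    simp only [mixPDF_neg, neg_zero] at h1
    have h2 := intervalIntegral.integral_Iic_add_Ioi (b := (0 : ℝ)) hint.integrableOn
      hint.integrableOn
    rw [integral_mixPDF hr hpos hanti, ← h1] at h2
    linarith
  rw [cdf_eq_real, measureReal_def, withDensity_apply _ measurableSet_Iic,
    ← ofReal_integral_eq_lintegral_ofReal (integrable_infoDensityPDF hr hpos hanti I).integrableOn
      (.of_forall fun x => infoDensityPDF_nonneg hr hpos hanti I x),
    ENNReal.toReal_ofReal (integral_nonneg fun x => infoDensityPDF_nonneg hr hpos hanti I x),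
    ← hhalf, ← intervalIntegral.integral_Iic_sub_Iic hint.integrableOn hint.integrableOn,
    add_sub_cancel, ← integral_indicator measurableSet_Iic]
  have e : ∀ a : ℝ, (Set.Iic x).indicator (infoDensityPDF r ρ I) a =
      (fun y => (Set.Iic ((x - I) / ρ (r - 1))).indicator (mixPDF r ρ) y / ρ (r - 1))
        ((a - I) / ρ (r - 1)) := by
    intro a
    have : (a - I) / ρ (r - 1) ≤ (x - I) / ρ (r - 1) ↔ a ≤ x := by
      rw [div_le_div_iff_of_pos_right hpos]; constructor <;> intro h <;> linarith
    by_cases ha : a ≤ x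
    · simp [Set.indicator, ha, this, infoDensityPDF]
    · simp [Set.indicator, ha, this]
  rw [integral_congr_ae (.of_forall e), integral_comp_sub_div hpos (fun y =>
    (Set.Iic ((x - I) / ρ (r - 1))).indicator (mixPDF r ρ) y / ρ (r - 1)), integral_div, integral_indicator measurableSet_Iic, smul_eq_mul]
  field_simp

lemma abs_cdf_sub_approxCDF_le (I : ℝ) (n : ℕ) (x : ℝ) :
    |cdf (volume.withDensity fun x => ENNReal.ofReal (infoDensityPDF r ρ I x)) x -
      approxCDF r ρ I n x| ≤ 1 / 2 * remainder r ρ n := by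
  rw [cdf_infoDensityPDF hr hpos hanti, approxCDF]
  split_ifs with h
  · have h0 : 0 ≤ I - x := by linarith
    have h1 : ∫ y in (0 : ℝ)..((x - I) / ρ (r - 1)), mixPDF r ρ y = -funV r ρ (I - x) := by
      rw [funV_eq_intervalIntegral hr hpos hanti h0, ← intervalIntegral.integral_symm]
      have := intervalIntegral.integral_comp_neg (a := 0) (b := (x - I) / ρ (r - 1)) (mixPDF r ρ)
      simp only [mixPDF_neg, neg_zero] at this
      rw [this, ← neg_div, neg_sub]
    rw [h1, abs_sub_comm]
    convert abs_funV_sub_approxV_le hr hpos hanti n h0 using 2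
    ring
  · have h0 : 0 ≤ x - I := by linarith
    rw [← funV_eq_intervalIntegral hr hpos hanti h0]
    convert abs_funV_sub_approxV_le hr hpos hanti n h0 using 2
    ring

end Mixture

/-! ### Densities of products of centred Gaussian distributions -/

open scoped NNReal ENNReal

section PiDensity

variable {ι : Type*} [Fintype ι]

/-- It suffices to compare on boxes, where the restricted density is a product of functions of
independent coordinates. -/
lemma pi_withDensity_prod {α : ι → Type*} [∀ i, MeasurableSpace (α i)]
    (μ : ∀ i, Measure (α i)) [∀ i, IsProbabilityMeasure (μ i)] {f : ∀ i, α i → ℝ≥0∞}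
    (hf : ∀ i, Measurable (f i)) [∀ i, SigmaFinite ((μ i).withDensity (f i))] :
    Measure.pi (fun i => (μ i).withDensity (f i)) =
      (Measure.pi μ).withDensity fun x => ∏ i, f i (x i) := by
  refine Measure.pi_eq fun s hs => ?_
  rw [withDensity_apply _ (MeasurableSet.univ_pi hs), ← lintegral_indicator (.univ_pi hs)]
  have h1 : ∀ x : ∀ i, α i, (Set.univ.pi s).indicator (fun x => ∏ i, f i (x i)) x =
      ∏ i, (s i).indicator (f i) (x i) := by
    intro x
    by_cases hx : x ∈ Set.univ.pi s
    · rw [Set.indicator_of_mem hx]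
      exact Finset.prod_congr rfl fun i _ => by rw [Set.indicator_of_mem (hx i trivial)]
    · rw [Set.indicator_of_notMem hx]
      simp only [Set.mem_univ_pi, not_forall] at hx
      obtain ⟨i, hi⟩ := hx
      exact (Finset.prod_eq_zero (Finset.mem_univ i) (Set.indicator_of_notMem hi _)).symm
  simp_rw [h1]
  have hm : ∀ i, Measurable ((s i).indicator (f i)) := fun i => (hf i).indicator (hs i)
  have hind : iIndepFun (fun i (x : ∀ i, α i) => (s i).indicator (f i) (x i)) (Measure.pi μ) :=
    iIndepFun_pi fun i => (hm i).aemeasurable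
  have h2 := lintegral_prod_eq_prod_lintegral_of_indepFun (μ := Measure.pi μ) Finset.univ
    (fun i (x : ∀ i, α i) => (s i).indicator (f i) (x i)) hind
    (fun i => (hm i).comp (measurable_pi_apply i))
  rw [h2]
  refine Finset.prod_congr rfl fun i _ => ?_
  rw [withDensity_apply _ (hs i), ← lintegral_indicator (hs i),
    (measurePreserving_eval μ i).lintegral_comp (hm i)]

lemma gaussianReal_eq_withDensity {v : ℝ≥0} (hv : v ≠ 0) :
    gaussianReal 0 v = (gaussianReal 0 1).withDensity fun x =>
      ENNReal.ofReal (Real.exp (1 / 2 * (1 - 1 / (v : ℝ)) * x ^ 2) / √(v : ℝ)) := by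
  have hv0 : (0 : ℝ) < v := by positivity
  rw [gaussianReal_of_var_ne_zero 0 hv, gaussianReal_of_var_ne_zero 0 one_ne_zero,
    ← withDensity_mul _ (measurable_gaussianPDF 0 1) (by fun_prop)]
  congr 1
  funext x
  rw [Pi.mul_apply, gaussianPDF, gaussianPDF, ← ENNReal.ofReal_mul (gaussianPDFReal_nonneg _ _ _)]
  congr 1
  simp only [gaussianPDFReal]
  have e : Real.exp (-(x - 0) ^ 2 / (2 * (v : ℝ))) = Real.exp (-(x - 0) ^ 2 / (2 * ((1 : ℝ≥0) : ℝ))) *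
      Real.exp (1 / 2 * (1 - 1 / (v : ℝ)) * x ^ 2) := by
    rw [← Real.exp_add]
    congr 1
    push_cast
    field_simp
    ring
  rw [e, Real.sqrt_mul (by positivity) (v : ℝ), NNReal.coe_one, mul_one]
  field_simp

/-- The quadratic form in the density of `⨂ N(0, v_j)` relative to `⨂ N(0, 1)`. -/
def gaussianQuadratic (v : ι → ℝ≥0) (z : ι → ℝ) : ℝ :=
  ∑ j, 1 / 2 * (1 - 1 / (v j : ℝ)) * z j ^ 2

lemma measurable_gaussianQuadratic (v : ι → ℝ≥0) : Measurable (gaussianQuadratic v) := by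
  unfold gaussianQuadratic; fun_prop

/-- The measure `⨂ N(0, v_j)`. -/
abbrev gaussianPi (v : ι → ℝ≥0) : Measure (ι → ℝ) := Measure.pi fun j => gaussianReal 0 (v j)

lemma gaussianPi_eq_withDensity {v : ι → ℝ≥0} (hv : ∀ j, v j ≠ 0) :
    gaussianPi v = (gaussianPi fun _ : ι => 1).withDensity fun z =>
      ENNReal.ofReal (Real.exp (gaussianQuadratic v z + ∑ j, -Real.log √(v j : ℝ))) := by
  have h1 : gaussianPi v = Measure.pi fun j => (gaussianReal 0 1).withDensity fun x =>
      ENNReal.ofReal (Real.exp (1 / 2 * (1 - 1 / (v j : ℝ)) * x ^ 2) / √(v j : ℝ)) := by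
    rw [gaussianPi]
    congr 1
    funext j
    exact gaussianReal_eq_withDensity (hv j)
  have hprob : ∀ j, IsProbabilityMeasure ((gaussianReal 0 1).withDensity fun x =>
      ENNReal.ofReal (Real.exp (1 / 2 * (1 - 1 / (v j : ℝ)) * x ^ 2) / √(v j : ℝ))) := fun j => by
    rw [← gaussianReal_eq_withDensity (hv j)]; infer_instance
  rw [h1, pi_withDensity_prod _ fun j => by fun_prop]
  congr 1
  funext z
  rw [← ENNReal.ofReal_prod_of_nonneg fun j _ => by positivity]
  congr 1
  rw [gaussianQuadratic, ← Finset.sum_add_distrib, Real.exp_sum]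
  refine Finset.prod_congr rfl fun j _ => ?_
  have : (0 : ℝ) < v j := by have := hv j; positivity
  rw [Real.exp_add, Real.exp_neg, Real.exp_log (by positivity), div_eq_mul_inv]

lemma integral_gaussianQuadratic {v : ι → ℝ≥0} (hv : ∀ j, v j ≠ 0) :
    Integrable (gaussianQuadratic v) (gaussianPi v) ∧
    ∫ z, gaussianQuadratic v z ∂(gaussianPi v) = 1 / 2 * ∑ j, ((v j : ℝ) - 1) := by
  have hint1 : ∀ j, Integrable (fun x : ℝ => x ^ 2) (gaussianReal 0 (v j)) := fun j =>
    (memLp_id_gaussianReal 2).integrable_sq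
  have hint : ∀ j, Integrable (fun z : ι → ℝ => 1 / 2 * (1 - 1 / (v j : ℝ)) * z j ^ 2)
      (gaussianPi v) := fun j =>
    ((measurePreserving_eval (fun j => gaussianReal 0 (v j)) j).integrable_comp_of_integrable
      (hint1 j)).const_mul _
  refine ⟨integrable_finsetSum _ fun j _ => hint j, ?_⟩
  simp only [gaussianQuadratic]
  rw [integral_finsetSum _ fun j _ => hint j, Finset.mul_sum]
  refine Finset.sum_congr rfl fun j _ => ?_
  have h2 : ∫ z : ι → ℝ, z j ^ 2 ∂(gaussianPi v) = v j := by
    have h4 := integral_map (μ := gaussianPi v) (φ := Function.eval j) (f := fun x : ℝ => x ^ 2)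
      (measurable_pi_apply j).aemeasurable (by fun_prop)
    rw [(measurePreserving_eval (fun j => gaussianReal 0 (v j)) j).map_eq] at h4
    have h5 := variance_fun_id_gaussianReal (μ := 0) (v := v j)
    rw [variance_eq_integral (by fun_prop)] at h5
    simp only [integral_id_gaussianReal, sub_zero] at h5
    rw [← h5, h4]
  rw [integral_const_mul, h2]
  have : (v j : ℝ) ≠ 0 := by exact_mod_cast hv j
  field_simp

/-- The square is computed so that no branch of the complex square root has to be tracked; the sign
is recovered later by continuity in `t`. -/
lemma sq_integral_cexp_gaussianReal {v : ℝ≥0} (hv : v ≠ 0) (t : ℝ) :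
    (∫ x : ℝ, Complex.exp (t * (1 / 2 * (1 - 1 / (v : ℝ)) * x ^ 2 : ℝ) * Complex.I)
      ∂(gaussianReal 0 v)) ^ 2 = 1 / (1 - t * ((v : ℝ) - 1 : ℝ) * Complex.I) := by
  have hv0 : (0 : ℝ) < v := by positivity
  have hvc : ((v : ℝ) : ℂ) ≠ 0 := by exact_mod_cast hv0.ne'
  rw [integral_gaussianReal_eq_integral_smul hv]
  set b : ℂ := (1 - t * ((v : ℝ) - 1 : ℝ) * Complex.I) / (2 * (v : ℝ)) with hb
  have hbre : 0 < b.re := by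
    have : b = ((1 / (2 * v) : ℝ) : ℂ) + ((-t * ((v : ℝ) - 1) / (2 * v) : ℝ) : ℂ) * Complex.I := by
      rw [hb]; push_cast; field_simp; ring
    rw [this]
    simp only [Complex.add_re, Complex.ofReal_re, Complex.re_ofReal_mul, Complex.I_re, mul_zero,
      add_zero]
    positivity
  have hb0 : b ≠ 0 := fun h => by simp [h] at hbre
  have e : ∀ x : ℝ, gaussianPDFReal 0 v x •
      Complex.exp (t * (1 / 2 * (1 - 1 / (v : ℝ)) * x ^ 2 : ℝ) * Complex.I) =
      (((√(2 * Real.pi * v))⁻¹ : ℝ) : ℂ) * Complex.exp (-b * x ^ 2) := by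
    intro x
    rw [gaussianPDFReal, Complex.real_smul, Complex.ofReal_mul, mul_assoc, Complex.ofReal_exp,
      ← Complex.exp_add]
    congr 2
    rw [hb]
    push_cast
    field_simp
    ring
  simp_rw [e]
  have hp : (Real.pi : ℂ) / b ≠ 0 := div_ne_zero (by exact_mod_cast Real.pi_ne_zero) hb0
  rw [integral_const_mul, integral_gaussian_complex hbre, mul_pow, ← Complex.ofReal_pow, inv_pow,
    Real.sq_sqrt (by positivity), sq ((_ : ℂ) ^ (1 / 2 : ℂ)), ← Complex.cpow_add _ _ hp]
  have h12 : (1 / 2 : ℂ) + 1 / 2 = 1 := by norm_num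
  have hpi : (Real.pi : ℂ) ≠ 0 := by exact_mod_cast Real.pi_ne_zero
  have hn : (1 - t * ((v : ℝ) - 1 : ℝ) * Complex.I) ≠ 0 := by
    intro h; rw [hb, h, zero_div] at hb0; exact hb0 rfl
  rw [h12, Complex.cpow_one, hb]
  push_cast at hn ⊢
  field_simp

lemma sq_integral_cexp_gaussianQuadratic {v : ι → ℝ≥0} (hv : ∀ j, v j ≠ 0) (t : ℝ) :
    (∫ z, Complex.exp (t * gaussianQuadratic v z * Complex.I) ∂(gaussianPi v)) ^ 2 =
      1 / ∏ j, (1 - t * ((v j : ℝ) - 1 : ℝ) * Complex.I) := by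
  have e : ∀ z : ι → ℝ, Complex.exp (t * gaussianQuadratic v z * Complex.I) =
      ∏ j, Complex.exp (t * (1 / 2 * (1 - 1 / (v j : ℝ)) * z j ^ 2 : ℝ) * Complex.I) := by
    intro z
    rw [← Complex.exp_sum, gaussianQuadratic, Complex.ofReal_sum, Finset.mul_sum, Finset.sum_mul]
  simp_rw [e]
  rw [integral_fintype_prod_eq_prod (fun j (x : ℝ) =>
    Complex.exp (t * (1 / 2 * (1 - 1 / (v j : ℝ)) * x ^ 2 : ℝ) * Complex.I)), ← Finset.prod_pow]
  simp only [sq_integral_cexp_gaussianReal (hv _)]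
  simp

end PiDensity

/-! ### The log-likelihood ratio of two Gaussian measures in diagonalizing coordinates -/

section LogLikelihood

variable {ι α : Type*} [Fintype ι] [MeasurableSpace α] {μ ν : Measure α} [IsProbabilityMeasure μ]
  [IsProbabilityMeasure ν] {Z : α → ι → ℝ} {v : ι → ℝ≥0}

/-- A measurable embedding preserves Radon–Nikodym derivatives, so the explicit density of the
Gaussian products pulls back. Absolute continuity turns `μ`-almost everywhere into `ν`-almost
everywhere. -/
lemma log_rnDeriv_ae_eq (hac : ν ≪ μ) (hZ : MeasurableEmbedding Z) (hv : ∀ j, v j ≠ 0)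
    (hν : ν.map Z = gaussianPi v) (hμ : μ.map Z = gaussianPi fun _ => 1) :
    ∀ᵐ x ∂ν, Real.log (ν.rnDeriv μ x).toReal =
      gaussianQuadratic v (Z x) + ∑ j, -Real.log √(v j : ℝ) := by
  have h1 := hZ.rnDeriv_map ν μ
  have hm : Measurable fun z : ι → ℝ =>
      ENNReal.ofReal (Real.exp (gaussianQuadratic v z + ∑ j, -Real.log √(v j : ℝ))) := by
    have := measurable_gaussianQuadratic v
    fun_prop
  have h2 := Measure.rnDeriv_withDensity (gaussianPi fun _ : ι => 1) hm
  rw [← gaussianPi_eq_withDensity hv, ← hν, ← hμ] at h2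
  have h3 := ae_of_ae_map hZ.measurable.aemeasurable h2
  filter_upwards [hac.ae_le h1, hac.ae_le h3] with x hx1 hx3
  rw [← hx1, hx3, ENNReal.toReal_ofReal (Real.exp_nonneg _), Real.log_exp]

lemma integral_log_rnDeriv (hac : ν ≪ μ) (hZ : MeasurableEmbedding Z) (hv : ∀ j, v j ≠ 0)
    (hν : ν.map Z = gaussianPi v) (hμ : μ.map Z = gaussianPi fun _ => 1) :
    ∫ x, Real.log (ν.rnDeriv μ x).toReal ∂ν =
      1 / 2 * ∑ j, ((v j : ℝ) - 1) + ∑ j, -Real.log √(v j : ℝ) := by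
  have hq := integral_gaussianQuadratic hv
  have hi : Integrable (fun x => gaussianQuadratic v (Z x)) ν := by
    have := hq.1
    rw [← hν] at this
    exact this.comp_measurable hZ.measurable
  rw [integral_congr_ae (log_rnDeriv_ae_eq hac hZ hv hν hμ), integral_add hi (integrable_const _),
    integral_const, ← hq.2, ← hν, hZ.integral_map]
  simp

lemma charFun_log_rnDeriv (hac : ν ≪ μ) (hZ : MeasurableEmbedding Z) (hv : ∀ j, v j ≠ 0)
    (hν : ν.map Z = gaussianPi v) (hμ : μ.map Z = gaussianPi fun _ => 1) (t : ℝ) :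
    charFun (ν.map fun x => Real.log (ν.rnDeriv μ x).toReal) t =
      Complex.exp ((∑ j, -Real.log √(v j : ℝ) : ℝ) * t * Complex.I) *
        charFun ((gaussianPi v).map (gaussianQuadratic v)) t := by
  have hmq := measurable_gaussianQuadratic v
  rw [charFun_apply_real, charFun_apply_real, integral_map (by fun_prop) (by fun_prop),
    integral_map (by fun_prop) (by fun_prop), ← hν, hZ.integral_map, ← integral_const_mul]
  refine integral_congr_ae ?_
  filter_upwards [log_rnDeriv_ae_eq hac hZ hv hν hμ] with x hx
  rw [hx, ← Complex.exp_add]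
  congr 1
  push_cast
  ring

end LogLikelihood

/-- Both sides are continuous with equal squares, the right one never vanishes, and both are 1 at `t
= 0`; connectedness of the line fixes the sign. -/
lemma charFun_gaussianQuadratic_eq_of_prod_eq {ι κ : Type*} [Fintype ι] {v : ι → ℝ≥0}
    (hv : ∀ j, v j ≠ 0) (s : Finset κ) (σ : κ → ℝ)
    (h : ∀ t : ℝ, ∏ j, (1 - t * ((v j : ℝ) - 1 : ℝ) * Complex.I) =
      ((∏ i ∈ s, (1 + (σ i * t) ^ 2) : ℝ) : ℂ)) (t : ℝ) :
    charFun ((gaussianPi v).map (gaussianQuadratic v)) t =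
      ((∏ i ∈ s, (1 / √(1 + (σ i * t) ^ 2)) : ℝ) : ℂ) := by
  have hmq := measurable_gaussianQuadratic v
  have : IsProbabilityMeasure ((gaussianPi v).map (gaussianQuadratic v)) :=
    Measure.isProbabilityMeasure_map hmq.aemeasurable
  have hpos : ∀ t, 0 < ∏ i ∈ s, (1 / √(1 + (σ i * t) ^ 2)) := fun t =>
    Finset.prod_pos fun i _ => by positivity
  have key := IsPreconnected.eq_of_sq_eq (S := (Set.univ : Set ℝ)) isPreconnected_univ
    (f := charFun ((gaussianPi v).map (gaussianQuadratic v)))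
    (g := fun t => ((∏ i ∈ s, (1 / √(1 + (σ i * t) ^ 2)) : ℝ) : ℂ))
    continuous_charFun.continuousOn ?_ ?_ ?_ (y := 0) trivial ?_
  · exact key trivial
  · refine (Complex.continuous_ofReal.comp (continuous_finsetProd _ fun i _ => ?_)).continuousOn
    exact continuous_const.div (by fun_prop) fun t => by positivity
  · intro t _
    simp only [Pi.pow_apply]
    rw [charFun_apply_real, integral_map (by fun_prop) (by fun_prop),
      sq_integral_cexp_gaussianQuadratic hv, h, ← Complex.ofReal_pow, ← Finset.prod_pow]
    push_cast
    rw [one_div, ← Finset.prod_inv_distrib]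
    refine Finset.prod_congr rfl fun i _ => ?_
    rw [one_div, inv_pow, ← Complex.ofReal_pow √_, Real.sq_sqrt (by positivity)]
    push_cast
    rfl
  · intro t _
    exact_mod_cast (hpos t).ne'
  · simp

/-! ### Linear algebra of whitening and canonical correlations -/

section LinearAlgebra

open Matrix

lemma inv_sqrt_properties {n : Type*} [Fintype n] [DecidableEq n] {R : Matrix n n ℝ}
    (hR : R.PosSemidef) (hdet : R.det ≠ 0) :
    ((CFC.sqrt R)⁻¹)ᵀ = (CFC.sqrt R)⁻¹ ∧ (CFC.sqrt R)⁻¹ * R * (CFC.sqrt R)⁻¹ = 1 ∧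
      IsUnit ((CFC.sqrt R)⁻¹).det := by
  have h0 : 0 ≤ R := hR.nonneg
  have hs : CFC.sqrt R * CFC.sqrt R = R := CFC.sqrt_mul_sqrt_self R h0
  have hsH : (CFC.sqrt R)ᵀ = CFC.sqrt R := by
    have h1 : (CFC.sqrt R).PosSemidef := Matrix.nonneg_iff_posSemidef.1 (CFC.sqrt_nonneg R)
    have := h1.isHermitian.eq
    rwa [Matrix.conjTranspose_eq_transpose_of_trivial] at this
  have hu : IsUnit (CFC.sqrt R).det := by
    rw [isUnit_iff_ne_zero]
    intro h
    rw [← hs, Matrix.det_mul, h, zero_mul] at hdet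
    exact hdet rfl
  refine ⟨?_, ?_, ?_⟩
  · rw [Matrix.transpose_nonsing_inv, hsH]
  · nth_rewrite 2 [← hs]
    rw [← Matrix.mul_assoc, Matrix.nonsing_inv_mul _ hu, Matrix.one_mul,
      Matrix.mul_nonsing_inv _ hu]
  · exact Matrix.isUnit_nonsing_inv_det _ hu

variable {p q : ℕ} (C : Matrix (Fin p) (Fin q) ℝ)

/-- The symmetric block matrix with off-diagonal blocks `C` and `Cᵀ`. -/
def offDiag : Matrix (Fin p ⊕ Fin q) (Fin p ⊕ Fin q) ℝ := Matrix.fromBlocks 0 C Cᵀ 0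

lemma isHermitian_offDiag : (offDiag C).IsHermitian := by
  rw [Matrix.IsHermitian, offDiag, Matrix.fromBlocks_conjTranspose]
  simp [Matrix.conjTranspose_eq_transpose_of_trivial]

lemma transpose_mul_self_eigenvectorUnitary {n : Type*} [Fintype n] [DecidableEq n]
    {A : Matrix n n ℝ} (hA : A.IsHermitian) :
    (hA.eigenvectorUnitary : Matrix n n ℝ)ᵀ * hA.eigenvectorUnitary = 1 := by
  have := Unitary.coe_star_mul_self hA.eigenvectorUnitary
  rwa [Matrix.star_eq_conjTranspose, Matrix.conjTranspose_eq_transpose_of_trivial] at this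

lemma transpose_mul_mul_eigenvectorUnitary {n : Type*} [Fintype n] [DecidableEq n]
    {A : Matrix n n ℝ} (hA : A.IsHermitian) :
    (hA.eigenvectorUnitary : Matrix n n ℝ)ᵀ * A * hA.eigenvectorUnitary =
      Matrix.diagonal hA.eigenvalues := by
  have := hA.conjStarAlgAut_star_eigenvectorUnitary
  rw [Unitary.conjStarAlgAut_star_apply] at this
  simpa [Matrix.star_eq_conjTranspose, Matrix.conjTranspose_eq_transpose_of_trivial,
    Function.comp_def] using! this

lemma det_one_sub_smul_eq_prod {n : Type*} [Fintype n] [DecidableEq n]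
    {A : Matrix n n ℝ} (hA : A.IsHermitian) (s : ℝ) :
    (1 - s • A).det = ∏ j, (1 - s * hA.eigenvalues j) := by
  have h1 := transpose_mul_self_eigenvectorUnitary hA
  have h2 := transpose_mul_mul_eigenvectorUnitary hA
  set O : Matrix n n ℝ := (hA.eigenvectorUnitary : Matrix n n ℝ)
  have h3 : Oᵀ * (1 - s • A) * O = Matrix.diagonal fun j => 1 - s * hA.eigenvalues j := by
    rw [Matrix.mul_sub, Matrix.sub_mul, Matrix.mul_one, h1, Matrix.mul_smul, Matrix.smul_mul, h2,
      ← Matrix.diagonal_one, ← Matrix.diagonal_smul, Matrix.diagonal_sub]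
    rfl
  have h4 : (1 - s • A).det = (Oᵀ * (1 - s • A) * O).det := by
    have := congrArg Matrix.det h1
    rw [Matrix.det_mul, Matrix.det_one] at this
    rw [Matrix.det_mul, Matrix.det_mul]
    linear_combination -(1 - s • A).det * this
  rw [h4, h3, Matrix.det_diagonal]

/-- Schur complement of the identity block. It passes from the eigenvalues of `offDiag C` to the
singular values of `C`. -/
lemma det_one_sub_smul_offDiag (s : ℝ) :
    (1 - s • offDiag C).det = (1 - s ^ 2 • (Cᵀ * C)).det := by
  have h : 1 - s • offDiag C = Matrix.fromBlocks 1 (-(s • C)) (-(s • Cᵀ)) 1 := by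
    rw [offDiag, ← Matrix.fromBlocks_one, Matrix.fromBlocks_smul, sub_eq_add_neg,
      Matrix.fromBlocks_neg, Matrix.fromBlocks_add]
    simp
  rw [h, Matrix.det_fromBlocks_one₁₁]
  congr 2
  rw [Matrix.neg_mul, Matrix.mul_neg, neg_neg, Matrix.smul_mul, Matrix.mul_smul, smul_smul, sq]

lemma charpoly_transpose_mul_self :
    (Cᵀ * C).charpoly = ∏ i : Fin q,
      (Polynomial.X - Polynomial.C ((Matrix.toEuclideanLin C).singularValues i ^ 2)) := by
  have hn : Module.finrank ℝ (EuclideanSpace ℝ (Fin q)) = q := by simp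
  have h := (Matrix.toEuclideanLin C).isSymmetric_adjoint_comp_self.charpoly_eq hn
  have h1 : (Matrix.toEuclideanLin C).adjoint ∘ₗ Matrix.toEuclideanLin C =
      Matrix.toEuclideanLin (Cᵀ * C) := by
    rw [← Matrix.toEuclideanLin_conjTranspose_eq_adjoint,
      Matrix.conjTranspose_eq_transpose_of_trivial]
    exact (Matrix.toLpLin_mul_same ..).symm
  have h2 : (Matrix.toEuclideanLin (Cᵀ * C)).charpoly = (Cᵀ * C).charpoly :=
    Matrix.charpoly_toLin (Cᵀ * C) (PiLp.basisFun 2 ℝ (Fin q))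
  rw [← h2, ← h1, h]
  refine Finset.prod_congr rfl fun i _ => ?_
  rw [LinearMap.sq_singularValues_fin _ hn]
  simp

/-- For `s ≠ 0` this is the characteristic polynomial of `Cᵀ * C` at `s⁻²`, rescaled by `s^(2q)`. -/
lemma det_one_sub_sq_smul (s : ℝ) :
    (1 - s ^ 2 • (Cᵀ * C)).det =
      ∏ i : Fin q, (1 - s ^ 2 * (Matrix.toEuclideanLin C).singularValues i ^ 2) := by
  rcases eq_or_ne s 0 with rfl | hs
  · simp
  have hs2 : s ^ 2 ≠ 0 := pow_ne_zero 2 hs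
  have h : 1 - s ^ 2 • (Cᵀ * C) = s ^ 2 • (Matrix.scalar (Fin q) (s ^ 2)⁻¹ - Cᵀ * C) := by
    rw [smul_sub, Matrix.scalar_apply, ← Matrix.diagonal_smul]
    congr 1
    rw [← Matrix.diagonal_one]
    congr 1
    funext i
    simp [hs2]
  rw [h, Matrix.det_smul, ← Matrix.eval_charpoly, charpoly_transpose_mul_self,
    Polynomial.eval_prod, Fintype.card_fin]
  have : (s ^ 2) ^ q = ∏ _i : Fin q, s ^ 2 := by simp
  rw [this, ← Finset.prod_mul_distrib]
  refine Finset.prod_congr rfl fun i _ => ?_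
  simp only [Polynomial.eval_sub, Polynomial.eval_X, Polynomial.eval_C]
  field_simp

lemma finrank_range_toEuclideanLin :
    Module.finrank ℝ (Matrix.toEuclideanLin C).range = C.rank :=
  (Matrix.rank_eq_finrank_range_toLin C (PiLp.basisFun 2 ℝ (Fin p))
    (PiLp.basisFun 2 ℝ (Fin q))).symm

lemma prod_singularValues_eq {r : ℕ} (hr : r = C.rank) (f : ℝ → ℝ) (hf : f 0 = 1) :
    ∏ i : Fin q, f ((Matrix.toEuclideanLin C).singularValues i) =
      ∏ i ∈ Finset.range r, f ((Matrix.toEuclideanLin C).singularValues i) := by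
  rw [← Finset.prod_range fun i => f ((Matrix.toEuclideanLin C).singularValues i)]
  have hrq : r ≤ q := by rw [hr]; simpa using C.rank_le_width
  symm
  refine Finset.prod_subset (Finset.range_mono hrq) fun i _ hi => ?_
  have h0 : (Matrix.toEuclideanLin C).singularValues i = 0 := by
    rw [LinearMap.singularValues_eq_zero_iff_le_finrank_range, finrank_range_toEuclideanLin, ← hr]
    simpa using hi
  rw [h0, hf]

lemma prod_one_sub_eigenvalues_offDiag {r : ℕ} (hr : r = C.rank) (s : ℝ) :
    ∏ j, (1 - s * (isHermitian_offDiag C).eigenvalues j) =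
      ∏ i ∈ Finset.range r, (1 - s ^ 2 * (Matrix.toEuclideanLin C).singularValues i ^ 2) := by
  rw [← det_one_sub_smul_eq_prod, det_one_sub_smul_offDiag, det_one_sub_sq_smul,
    prod_singularValues_eq C hr (fun x => 1 - s ^ 2 * x ^ 2) (by simp)]

/-- The real identity holds for every `s`, hence between polynomials, and may be evaluated at `s = i
t`, where `s² = -t²`. The eigenvalues never have to be matched explicitly with `±ρ_i`. -/
lemma prod_one_sub_I_mul_eigenvalues_offDiag {r : ℕ} (hr : r = C.rank) (t : ℝ) :
    ∏ j, (1 - t * ((isHermitian_offDiag C).eigenvalues j : ℝ) * Complex.I) =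
      ((∏ i ∈ Finset.range r, (1 + ((Matrix.toEuclideanLin C).singularValues i * t) ^ 2) : ℝ) :
        ℂ) := by
  have hpoly : (∏ j, (1 - Polynomial.X * Polynomial.C ((isHermitian_offDiag C).eigenvalues j)) :
      Polynomial ℝ) = ∏ i ∈ Finset.range r,
        (1 - Polynomial.X ^ 2 *
          Polynomial.C ((Matrix.toEuclideanLin C).singularValues i ^ 2)) := by
    refine Polynomial.funext fun s => ?_
    simpa only [Polynomial.eval_prod, Polynomial.eval_sub, Polynomial.eval_one, Polynomial.eval_mul,
      Polynomial.eval_X, Polynomial.eval_C, Polynomial.eval_pow] using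
      prod_one_sub_eigenvalues_offDiag C hr s
  have h := congrArg (Polynomial.aeval ((t : ℂ) * Complex.I)) hpoly
  simp only [map_prod, map_sub, map_mul, map_one, map_pow, Polynomial.aeval_X,
    Polynomial.aeval_C, Complex.coe_algebraMap] at h
  rw [Complex.ofReal_prod]
  convert h using 2 with j _ i _
  · ring
  · push_cast
    rw [mul_pow _ Complex.I, Complex.I_sq]
    ring

/-- The reason why the additive constant of the log density is exactly the mutual information. -/
lemma trace_offDiag_eigenvalues : ∑ j, (isHermitian_offDiag C).eigenvalues j = 0 := by
  have h := (isHermitian_offDiag C).trace_eq_sum_eigenvalues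
  simp only [RCLike.ofReal_real_eq_id, id] at h
  rw [← h, offDiag, Matrix.trace, Fintype.sum_sum_type]
  simp

/-- The matrix that whitens both vectors and diagonalizes their joint covariance. -/
def canonicalTransform (A : Matrix (Fin p) (Fin p) ℝ) (B : Matrix (Fin q) (Fin q) ℝ) :
    Matrix (Fin p ⊕ Fin q) (Fin p ⊕ Fin q) ℝ :=
  ((isHermitian_offDiag C).eigenvectorUnitary : Matrix _ _ ℝ)ᵀ * Matrix.fromBlocks A 0 0 B

variable {A RX : Matrix (Fin p) (Fin p) ℝ} {B RY : Matrix (Fin q) (Fin q) ℝ}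
  {RXY : Matrix (Fin p) (Fin q) ℝ}

lemma isUnit_det_canonicalTransform (hA : IsUnit A.det) (hB : IsUnit B.det) :
    IsUnit (canonicalTransform C A B).det := by
  have h1 := congrArg Matrix.det (transpose_mul_self_eigenvectorUnitary (isHermitian_offDiag C))
  rw [Matrix.det_mul, Matrix.det_one] at h1
  rw [canonicalTransform, Matrix.det_mul, Matrix.det_fromBlocks_zero₂₁]
  exact (IsUnit.of_mul_eq_one _ h1).mul (hA.mul hB)

lemma canonicalTransform_mul_blockDiag (hAt : Aᵀ = A) (hBt : Bᵀ = B) (hA : A * RX * A = 1)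
    (hB : B * RY * B = 1) :
    canonicalTransform C A B * Matrix.fromBlocks RX 0 0 RY * (canonicalTransform C A B)ᵀ = 1 := by
  have h : Matrix.fromBlocks A 0 0 B * Matrix.fromBlocks RX 0 0 RY *
      (Matrix.fromBlocks A 0 0 B)ᵀ = 1 := by
    rw [Matrix.fromBlocks_transpose, Matrix.fromBlocks_multiply, Matrix.fromBlocks_multiply]
    simp [hAt, hBt, hA, hB]
  rw [canonicalTransform, Matrix.transpose_mul, Matrix.transpose_transpose]
  calc _ = ((isHermitian_offDiag C).eigenvectorUnitary : Matrix _ _ ℝ)ᵀ *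
        (Matrix.fromBlocks A 0 0 B * Matrix.fromBlocks RX 0 0 RY * (Matrix.fromBlocks A 0 0 B)ᵀ) *
        ((isHermitian_offDiag C).eigenvectorUnitary : Matrix _ _ ℝ) := by
        simp only [Matrix.mul_assoc]
    _ = 1 := by rw [h, Matrix.mul_one, transpose_mul_self_eigenvectorUnitary]

lemma canonicalTransform_mul_joint (hAt : Aᵀ = A) (hBt : Bᵀ = B) (hA : A * RX * A = 1)
    (hB : B * RY * B = 1) (hC : C = A * RXY * B) :
    canonicalTransform C A B * Matrix.fromBlocks RX RXY RXYᵀ RY * (canonicalTransform C A B)ᵀ =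
      Matrix.diagonal fun j => 1 + (isHermitian_offDiag C).eigenvalues j := by
  have hCt : Cᵀ = B * RXYᵀ * A := by
    rw [hC, Matrix.transpose_mul, Matrix.transpose_mul, hAt, hBt, Matrix.mul_assoc]
  have h : Matrix.fromBlocks A 0 0 B * Matrix.fromBlocks RX RXY RXYᵀ RY *
      (Matrix.fromBlocks A 0 0 B)ᵀ = 1 + offDiag C := by
    rw [Matrix.fromBlocks_transpose, Matrix.fromBlocks_multiply, Matrix.fromBlocks_multiply,
      offDiag, ← Matrix.fromBlocks_one, Matrix.fromBlocks_add]
    simp [hAt, hBt, hA, hB, ← hC, ← hCt]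
  rw [canonicalTransform, Matrix.transpose_mul, Matrix.transpose_transpose]
  calc _ = ((isHermitian_offDiag C).eigenvectorUnitary : Matrix _ _ ℝ)ᵀ *
        (Matrix.fromBlocks A 0 0 B * Matrix.fromBlocks RX RXY RXYᵀ RY *
          (Matrix.fromBlocks A 0 0 B)ᵀ) *
        ((isHermitian_offDiag C).eigenvectorUnitary : Matrix _ _ ℝ) := by
        simp only [Matrix.mul_assoc]
    _ = _ := by
      rw [h, Matrix.mul_add, Matrix.add_mul, Matrix.mul_one, transpose_mul_self_eigenvectorUnitary,
        transpose_mul_mul_eigenvectorUnitary, ← Matrix.diagonal_one, Matrix.diagonal_add]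

end LinearAlgebra

/-! ### Diagonalizing a pair of Gaussian measures -/

lemma covariance_mulVec {α ι κ : Type*} [MeasurableSpace α] [Fintype ι] {Q : Measure α}
    [IsFiniteMeasure Q] {W : ι → α → ℝ} (hW : ∀ a, MemLp (W a) 2 Q) (T : Matrix κ ι ℝ) (j k : κ) :
    cov[fun x => T.mulVec (fun a => W a x) j, fun x => T.mulVec (fun a => W a x) k; Q] =
      (T * (Matrix.of fun a b => cov[W a, W b; Q]) * T.transpose) j k := by
  simp only [Matrix.mulVec, dotProduct]
  rw [covariance_fun_sum_fun_sum (fun a => (hW a).const_mul _) (fun a => (hW a).const_mul _)]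
  simp only [covariance_const_mul_left, covariance_const_mul_right, Matrix.mul_apply,
    Matrix.of_apply, Matrix.transpose_apply, Finset.sum_mul]
  rw [Finset.sum_comm]
  exact Finset.sum_congr rfl fun a _ => Finset.sum_congr rfl fun b _ => by ring

lemma posSemidef_covariance {α ι : Type*} [MeasurableSpace α] [Fintype ι] {Q : Measure α}
    [IsFiniteMeasure Q] {W : ι → α → ℝ} (hW : ∀ a, MemLp (W a) 2 Q) :
    (Matrix.of fun a b => cov[W a, W b; Q]).PosSemidef := by
  refine Matrix.PosSemidef.of_dotProduct_mulVec_nonneg ?_ fun x => ?_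
  · ext a b
    simp [covariance_comm]
  · have h := covariance_mulVec hW (Matrix.of fun (_ : Unit) a => x a) () ()
    have hm : AEMeasurable (fun y => (Matrix.of fun (_ : Unit) a => x a).mulVec
        (fun a => W a y) ()) Q := by
      simp only [Matrix.mulVec, dotProduct]
      exact Finset.aemeasurable_fun_sum _ fun a _ =>
        (hW a).aestronglyMeasurable.aemeasurable.const_mul _
    rw [covariance_self hm] at h
    have h0 := variance_nonneg (fun y => (Matrix.of fun (_ : Unit) a => x a).mulVec
        (fun a => W a y) ()) Q
    rw [h] at h0
    refine h0.trans_eq ?_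
    rw [Matrix.mul_assoc, Matrix.mul_apply]
    rfl

/-- Jointly Gaussian coordinates with diagonal covariance are independent. Zero variances are
allowed, since nondegeneracy of the joint law is not yet known when this is applied. -/
lemma map_eq_gaussianPi {E ι : Type*} [NormedAddCommGroup E] [NormedSpace ℝ E]
    [MeasurableSpace E] [BorelSpace E] [Fintype ι] [DecidableEq ι]
    {Q : Measure E} [IsGaussian Q] (L : E →L[ℝ] (ι → ℝ)) {m : ι → ℝ} {v : ι → ℝ≥0}
    (hm : ∀ j, ∫ x, L x j ∂Q = m j)
    (hv : ∀ j k, cov[fun x => L x j, fun x => L x k; Q] =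
      Matrix.diagonal (fun j => (v j : ℝ)) j k) :
    Q.map (fun x => L x - m) = gaussianPi v := by
  have hL : Measurable fun x => L x := L.continuous.measurable
  have hG : HasGaussianLaw (fun x j => L x j - m j) Q := by
    refine ⟨?_⟩
    have : Q.map (fun x j => L x j - m j) = (Q.map L).map (fun y => y - m) := by
      rw [Measure.map_map (by fun_prop) hL]
      rfl
    rw [this]
    infer_instance
  have hLG : HasGaussianLaw (fun x j => L x j) Q := IsGaussian.hasGaussianLaw_id.map_fun L
  have hint : ∀ j, Integrable (fun x => L x j) Q := fun j => (hLG.eval j).integrable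
  have hcov : ∀ j k, cov[fun x => L x j - m j, fun x => L x k - m k; Q] =
      Matrix.diagonal (fun j => (v j : ℝ)) j k := fun j k => by
    rw [covariance_sub_const_left (hint j), covariance_sub_const_right (hint k), hv]
  have hind : iIndepFun (fun j x => L x j - m j) Q :=
    hG.iIndepFun_of_covariance_eq_zero fun j k hjk => by
      rw [hcov, Matrix.diagonal_apply_ne _ hjk]
  have hmeas : ∀ j, AEMeasurable (fun x => L x j - m j) Q := fun j => by fun_prop
  have h := hind.map_fun_eq_pi_map hmeas
  refine h.trans ?_
  rw [gaussianPi]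
  congr 1
  funext j
  rw [(hG.eval j).map_eq_gaussianReal, ← covariance_self (hmeas j), hcov,
    Matrix.diagonal_apply_eq, Real.toNNReal_coe, integral_sub (hint j) (integrable_const _), hm]
  simp

/-! ### Jointly Gaussian pairs and the characteristic function of the information density. -/

section Joint

variable {p q : ℕ}

/-- The coordinates of a pair of vectors, as one continuous linear map. -/
def jointCoord (p q : ℕ) :
    (EuclideanSpace ℝ (Fin p) × EuclideanSpace ℝ (Fin q)) →L[ℝ] (Fin p ⊕ Fin q → ℝ) :=
  ContinuousLinearMap.pi (Sum.elim
    (fun i => (EuclideanSpace.proj (𝕜 := ℝ) i).comp (ContinuousLinearMap.fst ℝ _ _))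
    (fun i => (EuclideanSpace.proj (𝕜 := ℝ) i).comp (ContinuousLinearMap.snd ℝ _ _)))

@[simp] lemma jointCoord_inl (x : EuclideanSpace ℝ (Fin p) × EuclideanSpace ℝ (Fin q))
    (i : Fin p) : jointCoord p q x (Sum.inl i) = x.1 i := rfl

@[simp] lemma jointCoord_inr (x : EuclideanSpace ℝ (Fin p) × EuclideanSpace ℝ (Fin q))
    (i : Fin q) : jointCoord p q x (Sum.inr i) = x.2 i := rfl

lemma injective_jointCoord : Function.Injective (jointCoord p q) := by
  intro x y h
  refine Prod.ext (PiLp.ext fun i => ?_) (PiLp.ext fun i => ?_)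
  · exact congrFun h (Sum.inl i)
  · exact congrFun h (Sum.inr i)

/-- The coordinates of a pair of vectors, transformed by the matrix `T`. -/
def transformedCoord (T : Matrix (Fin p ⊕ Fin q) (Fin p ⊕ Fin q) ℝ) :
    (EuclideanSpace ℝ (Fin p) × EuclideanSpace ℝ (Fin q)) →L[ℝ] (Fin p ⊕ Fin q → ℝ) :=
  (LinearMap.toContinuousLinearMap (Matrix.toLin' T)).comp (jointCoord p q)

lemma transformedCoord_apply (T : Matrix (Fin p ⊕ Fin q) (Fin p ⊕ Fin q) ℝ)
    (x : EuclideanSpace ℝ (Fin p) × EuclideanSpace ℝ (Fin q)) :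
    transformedCoord T x = T.mulVec (jointCoord p q x) := rfl

lemma measurableEmbedding_transformedCoord_sub
    {T : Matrix (Fin p ⊕ Fin q) (Fin p ⊕ Fin q) ℝ} (hT : IsUnit T.det) (m : Fin p ⊕ Fin q → ℝ) :
    MeasurableEmbedding fun x => transformedCoord T x - m := by
  refine Continuous.measurableEmbedding (by fun_prop) fun x y h => ?_
  have h' : T.mulVec (jointCoord p q x) = T.mulVec (jointCoord p q y) := by
    simpa [transformedCoord_apply] using h
  exact injective_jointCoord
    (Matrix.mulVec_injective_iff_isUnit.2 ((Matrix.isUnit_iff_isUnit_det T).2 hT) h')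

variable {Ω : Type*} [MeasurableSpace Ω] {P : Measure Ω} [IsProbabilityMeasure P]
  {X : Ω → EuclideanSpace ℝ (Fin p)} {Y : Ω → EuclideanSpace ℝ (Fin q)}

lemma memLp_jointCoord {Q : Measure (EuclideanSpace ℝ (Fin p) × EuclideanSpace ℝ (Fin q))}
    [IsGaussian Q] (a : Fin p ⊕ Fin q) : MemLp (fun x => jointCoord p q x a) 2 Q := by
  have h : HasGaussianLaw (fun x j => jointCoord p q x j) Q :=
    IsGaussian.hasGaussianLaw_id.map_fun (jointCoord p q)
  exact (h.eval a).memLp_two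

lemma posSemidef_covMatrix {n : ℕ} {V : Ω → EuclideanSpace ℝ (Fin n)} (hV : HasGaussianLaw V P) :
    (covMatrix P V V).PosSemidef :=
  posSemidef_covariance (W := fun i ω => V ω i) fun i =>
    (hV.map_fun (EuclideanSpace.proj (𝕜 := ℝ) i)).memLp_two

variable (hG : HasGaussianLaw (fun ω => (X ω, Y ω)) P)
include hG

omit [IsProbabilityMeasure P] in
lemma jointCov_map_eq :
    (Matrix.of fun a b => cov[fun x => jointCoord p q x a, fun x => jointCoord p q x b;
      P.map fun ω => (X ω, Y ω)]) =
    Matrix.fromBlocks (covMatrix P X X) (covMatrix P X Y) (covMatrix P X Y).transpose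
      (covMatrix P Y Y) := by
  have hm : ∀ a, AEStronglyMeasurable (fun x => jointCoord p q x a) (P.map fun ω => (X ω, Y ω)) :=
    fun a => Continuous.aestronglyMeasurable (by fun_prop)
  ext a b
  rw [Matrix.of_apply, covariance_map_fun (hm a) (hm b) hG.aemeasurable]
  rcases a with i | i <;> rcases b with j | j <;> simp [covMatrix]
  exact covariance_comm _ _

omit [IsProbabilityMeasure P] in
lemma map_fst_joint : (P.map fun ω => (X ω, Y ω)).map Prod.fst = P.map X := by
  rw [AEMeasurable.map_map_of_aemeasurable measurable_fst.aemeasurable hG.aemeasurable]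
  rfl

omit [IsProbabilityMeasure P] in
lemma map_snd_joint : (P.map fun ω => (X ω, Y ω)).map Prod.snd = P.map Y := by
  rw [AEMeasurable.map_map_of_aemeasurable measurable_snd.aemeasurable hG.aemeasurable]
  rfl

lemma jointCov_prod_eq :
    (Matrix.of fun a b => cov[fun x => jointCoord p q x a, fun x => jointCoord p q x b;
      (P.map X).prod (P.map Y)]) =
    Matrix.fromBlocks (covMatrix P X X) 0 0 (covMatrix P Y Y) := by
  have hX := hG.fst
  have hY := hG.snd
  have := hX.isGaussian_map
  have := hY.isGaussian_map
  have hXi : ∀ i, MemLp (fun x : EuclideanSpace ℝ (Fin p) => x i) 2 (P.map X) := fun i =>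
    (IsGaussian.hasGaussianLaw_id.map_fun (EuclideanSpace.proj (𝕜 := ℝ) i)).memLp_two
  have hYi : ∀ i, MemLp (fun x : EuclideanSpace ℝ (Fin q) => x i) 2 (P.map Y) := fun i =>
    (IsGaussian.hasGaussianLaw_id.map_fun (EuclideanSpace.proj (𝕜 := ℝ) i)).memLp_two
  have hXX : ∀ i j, cov[fun x => x.1 i, fun x => x.1 j; (P.map X).prod (P.map Y)] =
      covMatrix P X X i j := fun i j => by
    rw [covMatrix, Matrix.of_apply, ← covariance_map_fun (Z := X) (X := fun x => x i)
      (Y := fun x => x j) (hXi i).1 (hXi j).1 hX.aemeasurable]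
    have h := (measurePreserving_fst (μ := P.map X) (ν := P.map Y)).map_eq
    conv_rhs => rw [← h]
    rw [covariance_map_fun _ _ measurable_fst.aemeasurable] <;> rw [h]
    exacts [(hXi i).1, (hXi j).1]
  have hYY : ∀ i j, cov[fun x => x.2 i, fun x => x.2 j; (P.map X).prod (P.map Y)] =
      covMatrix P Y Y i j := fun i j => by
    rw [covMatrix, Matrix.of_apply, ← covariance_map_fun (Z := Y) (X := fun x => x i)
      (Y := fun x => x j) (hYi i).1 (hYi j).1 hY.aemeasurable]
    have h := (measurePreserving_snd (μ := P.map X) (ν := P.map Y)).map_eq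
    conv_rhs => rw [← h]
    rw [covariance_map_fun _ _ measurable_snd.aemeasurable] <;> rw [h]
    exacts [(hYi i).1, (hYi j).1]
  ext a b
  rw [Matrix.of_apply]
  rcases a with i | i <;> rcases b with j | j <;>
    simp only [jointCoord_inl, jointCoord_inr, Matrix.fromBlocks_apply₁₁, Matrix.fromBlocks_apply₁₂,
      Matrix.fromBlocks_apply₂₁, Matrix.fromBlocks_apply₂₂, Matrix.zero_apply, hXX, hYY]
  · exact covariance_fst_snd_prod (hXi i) (hYi j)
  · rw [covariance_comm]
    exact covariance_fst_snd_prod (hXi j) (hYi i)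

/-- The joint and product laws share their marginals, so one centring vector serves both. -/
lemma integral_jointCoord_prod (a : Fin p ⊕ Fin q) :
    ∫ x, jointCoord p q x a ∂((P.map X).prod (P.map Y)) =
      ∫ x, jointCoord p q x a ∂(P.map fun ω => (X ω, Y ω)) := by
  have hX := hG.fst
  have hY := hG.snd
  have := hX.isGaussian_map
  have := hY.isGaussian_map
  have h1 := (measurePreserving_fst (μ := P.map X) (ν := P.map Y)).map_eq
  have h2 := (measurePreserving_snd (μ := P.map X) (ν := P.map Y)).map_eq
  rcases a with i | i
  · have hm : ∀ Q : Measure (EuclideanSpace ℝ (Fin p) × EuclideanSpace ℝ (Fin q)),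
        ∫ x, x.1 i ∂Q = ∫ y, y i ∂(Q.map Prod.fst) := fun Q =>
      (integral_map (f := fun y : EuclideanSpace ℝ (Fin p) => y i) measurable_fst.aemeasurable
        (Continuous.aestronglyMeasurable (by fun_prop))).symm
    simp only [jointCoord_inl]
    rw [hm, hm, h1, map_fst_joint hG]
  · have hm : ∀ Q : Measure (EuclideanSpace ℝ (Fin p) × EuclideanSpace ℝ (Fin q)),
        ∫ x, x.2 i ∂Q = ∫ y, y i ∂(Q.map Prod.snd) := fun Q =>
      (integral_map (f := fun y : EuclideanSpace ℝ (Fin q) => y i) measurable_snd.aemeasurable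
        (Continuous.aestronglyMeasurable (by fun_prop))).symm
    simp only [jointCoord_inr]
    rw [hm, hm, h2, map_snd_joint hG]

/-- A pair of jointly Gaussian vectors whose joint law is absolutely continuous with respect to the
product of the marginals is diagonalized, simultaneously with the product measure. -/
lemma exists_diagonalization (hX : (covMatrix P X X).det ≠ 0) (hY : (covMatrix P Y Y).det ≠ 0)
    (hac : (P.map fun ω => (X ω, Y ω)) ≪ (P.map X).prod (P.map Y)) :
    ∃ (Z : EuclideanSpace ℝ (Fin p) × EuclideanSpace ℝ (Fin q) → (Fin p ⊕ Fin q → ℝ))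
      (v : Fin p ⊕ Fin q → ℝ≥0), MeasurableEmbedding Z ∧ (∀ j, v j ≠ 0) ∧
      (P.map fun ω => (X ω, Y ω)).map Z = gaussianPi v ∧
      ((P.map X).prod (P.map Y)).map Z = gaussianPi (fun _ => 1) ∧
      ∀ j, (v j : ℝ) = 1 + (isHermitian_offDiag (coherenceMatrix P X Y)).eigenvalues j := by
  have hXG := hG.fst
  have hYG := hG.snd
  have := hXG.isGaussian_map
  have := hYG.isGaussian_map
  have := hG.isGaussian_map
  obtain ⟨hAt, hA, hAu⟩ := inv_sqrt_properties (posSemidef_covMatrix hXG) hX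
  obtain ⟨hBt, hB, hBu⟩ := inv_sqrt_properties (posSemidef_covMatrix hYG) hY
  set C := coherenceMatrix P X Y with hC
  set T := canonicalTransform C (CFC.sqrt (covMatrix P X X))⁻¹ (CFC.sqrt (covMatrix P Y Y))⁻¹
    with hT
  have hTu : IsUnit T.det := isUnit_det_canonicalTransform C hAu hBu
  set ν := P.map fun ω => (X ω, Y ω) with hν
  set μ := (P.map X).prod (P.map Y) with hμ
  have hcν : ∀ j k, cov[fun x => transformedCoord T x j, fun x => transformedCoord T x k; ν] =
      Matrix.diagonal (fun j => 1 + (isHermitian_offDiag C).eigenvalues j) j k := fun j k => by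
    have h := covariance_mulVec (Q := ν) (W := fun a x => jointCoord p q x a)
      (fun a => memLp_jointCoord a) T j k
    rw [jointCov_map_eq hG, canonicalTransform_mul_joint C hAt hBt hA hB rfl] at h
    exact h
  have hcμ : ∀ j k, cov[fun x => transformedCoord T x j, fun x => transformedCoord T x k; μ] =
      Matrix.diagonal (fun _ => (((1 : ℝ≥0) : ℝ))) j k := fun j k => by
    have h := covariance_mulVec (Q := μ) (W := fun a x => jointCoord p q x a)
      (fun a => memLp_jointCoord a) T j k
    rw [jointCov_prod_eq hG, canonicalTransform_mul_blockDiag C hAt hBt hA hB] at h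
    rw [NNReal.coe_one, Matrix.diagonal_one]
    exact h
  -- These numbers are variances of the transformed coordinates under the joint law.
  have hnn : ∀ j, 0 ≤ 1 + (isHermitian_offDiag C).eigenvalues j := fun j => by
    have h := hcν j j
    rw [Matrix.diagonal_apply_eq, covariance_self (by fun_prop)] at h
    rw [← h]
    exact variance_nonneg _ _
  set m : Fin p ⊕ Fin q → ℝ := fun j => ∫ x, transformedCoord T x j ∂ν with hm
  have hmμ : ∀ j, ∫ x, transformedCoord T x j ∂μ = m j := fun j => by
    simp only [hm, transformedCoord_apply, Matrix.mulVec, dotProduct]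
    rw [integral_finsetSum _ fun a _ => ((memLp_jointCoord a).integrable one_le_two).const_mul _,
      integral_finsetSum _ fun a _ => ((memLp_jointCoord a).integrable one_le_two).const_mul _]
    refine Finset.sum_congr rfl fun a _ => ?_
    rw [integral_const_mul, integral_const_mul, integral_jointCoord_prod hG]
  obtain ⟨v, hv⟩ : ∃ v : Fin p ⊕ Fin q → ℝ≥0,
      ∀ j, (v j : ℝ) = 1 + (isHermitian_offDiag C).eigenvalues j :=
    ⟨fun j => (1 + (isHermitian_offDiag C).eigenvalues j).toNNReal,
      fun j => Real.coe_toNNReal _ (hnn j)⟩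
  simp only [← hv] at hcν
  have hmapν : ν.map (fun x => transformedCoord T x - m) = gaussianPi v := map_eq_gaussianPi _ (fun _ => rfl) hcν
  have hmapμ : μ.map (fun x => transformedCoord T x - m) = gaussianPi fun _ => 1 :=
    map_eq_gaussianPi _ hmμ hcμ
  have hemb := measurableEmbedding_transformedCoord_sub hTu m
  refine ⟨fun x => transformedCoord T x - m, v, hemb, fun j hj => ?_, hmapν, hmapμ, hv⟩
  -- If `v j = 0`, the hyperplane `z j = 0` has full mass under the joint law but is null under the
  -- product law, against absolute continuity.
  have happly : ∀ v : Fin p ⊕ Fin q → ℝ≥0,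
      gaussianPi v {z | z j = 0} = gaussianReal 0 (v j) {0} := fun v =>
    (measurePreserving_eval (fun j => gaussianReal 0 (v j)) j).measure_preimage
      (measurableSet_singleton 0).nullMeasurableSet
  have h0 : μ ((fun x => transformedCoord T x - m) ⁻¹' {z | z j = 0}) = 0 := by
    rw [← hemb.map_apply, hmapμ, happly]
    have := nullSingletonClass_gaussianReal (μ := 0) (v := 1) one_ne_zero
    exact measure_singleton 0
  have h1 := hac h0
  rw [← hemb.map_apply, hmapν, happly] at h1
  rw [hj, gaussianReal_zero_var] at h1
  simp at h1

lemma charFun_infoDensity_eq (hX : (covMatrix P X X).det ≠ 0) (hY : (covMatrix P Y Y).det ≠ 0)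
    (hac : (P.map fun ω => (X ω, Y ω)) ≪ (P.map X).prod (P.map Y))
    {r : ℕ} (hr : r = (coherenceMatrix P X Y).rank) (t : ℝ) :
    charFun (P.map (infoDensity P X Y)) t =
      Complex.exp (mutualInfo P X Y * t * Complex.I) *
        ((∏ i ∈ Finset.range r, (1 / √(1 + (canonicalCorr P X Y i * t) ^ 2)) : ℝ) : ℂ) := by
  have hXG := hG.fst
  have hYG := hG.snd
  have := hXG.isGaussian_map
  have := hYG.isGaussian_map
  have := hG.isGaussian_map
  obtain ⟨Z, v, hZ, hv, hνZ, hμZ, hva⟩ := exists_diagonalization hG hX hY hac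
  set ν := P.map fun ω => (X ω, Y ω) with hν
  set μ := (P.map X).prod (P.map Y) with hμ
  have hmeas : Measurable fun x => Real.log (ν.rnDeriv μ x).toReal :=
    (Measure.measurable_rnDeriv ν μ).ennreal_toReal.log
  have hmap : P.map (infoDensity P X Y) = ν.map fun x => Real.log (ν.rnDeriv μ x).toReal := by
    rw [hν, AEMeasurable.map_map_of_aemeasurable hmeas.aemeasurable hG.aemeasurable]
    rfl
  have hI : mutualInfo P X Y = ∑ j, -Real.log √(v j : ℝ) := by
    have h1 : mutualInfo P X Y = ∫ x, Real.log (ν.rnDeriv μ x).toReal ∂ν := by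
      rw [hν, integral_map hG.aemeasurable hmeas.aestronglyMeasurable]
      rfl
    rw [h1, integral_log_rnDeriv hac hZ hv hνZ hμZ]
    simp only [hva, add_sub_cancel_left]
    -- The mean of the quadratic form is half the sum of the eigenvalues, hence 0.
    rw [trace_offDiag_eigenvalues, mul_zero, zero_add]
  rw [hmap, charFun_log_rnDeriv hac hZ hv hνZ hμZ, hI]
  congr 1
  refine charFun_gaussianQuadratic_eq_of_prod_eq hv (Finset.range r) (canonicalCorr P X Y)
    (fun t => ?_) t
  simp only [hva, add_sub_cancel_left]
  exact prod_one_sub_I_mul_eigenvalues_offDiag (coherenceMatrix P X Y) hr t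

end Joint

lemma rank_coherenceMatrix {Ω : Type*} [MeasurableSpace Ω] {P : Measure Ω}
    [IsProbabilityMeasure P] {p q : ℕ} {X : Ω → EuclideanSpace ℝ (Fin p)}
    {Y : Ω → EuclideanSpace ℝ (Fin q)} (hG : HasGaussianLaw (fun ω => (X ω, Y ω)) P)
    (hX : (covMatrix P X X).det ≠ 0) (hY : (covMatrix P Y Y).det ≠ 0) :
    (coherenceMatrix P X Y).rank = (covMatrix P X Y).rank := by
  rw [coherenceMatrix, Matrix.rank_mul_eq_left_of_isUnit_det _ _
      (inv_sqrt_properties (posSemidef_covMatrix hG.snd) hY).2.2,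
    Matrix.rank_mul_eq_right_of_isUnit_det _ _
      (inv_sqrt_properties (posSemidef_covMatrix hG.fst) hX).2.2]

end InfoDensity

end

/-! ### Conclusion: identification of the law and transfer of the bounds. -/

theorem mainTheorem9 {Ω : Type*} [MeasurableSpace Ω] (P : Measure Ω) [IsProbabilityMeasure P]
    (p q : ℕ) (X : Ω → EuclideanSpace ℝ (Fin p)) (Y : Ω → EuclideanSpace ℝ (Fin q))
    (hGauss : HasGaussianLaw (fun ω => (X ω, Y ω)) P)
    (hX : (InfoDensity.covMatrix P X X).det ≠ 0)
    (hY : (InfoDensity.covMatrix P Y Y).det ≠ 0)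
    (hac : (P.map fun ω => (X ω, Y ω)) ≪ (P.map X).prod (P.map Y))
    (r : ℕ) (hr : r = (InfoDensity.covMatrix P X Y).rank) (hr2 : 2 ≤ r)
    (ρ : ℕ → ℝ) (hρ : ρ = InfoDensity.canonicalCorr P X Y)
    (I : ℝ) (hI : I = InfoDensity.mutualInfo P X Y) :
    -- the information density has a continuous PDF, and this PDF obeys the error bound
    (∃ f : ℝ → ℝ, Continuous f ∧ (∀ x, 0 ≤ f x) ∧
      P.map (InfoDensity.infoDensity P X Y) =
        volume.withDensity (fun x => ENNReal.ofReal (f x)) ∧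
      ∀ (n : ℕ) (x : ℝ), |f x - InfoDensity.approxPDF r ρ I n x| ≤
        Real.Gamma (((r : ℝ) - 1) / 2 + n) /
            (2 * ρ (r - 1) * √Real.pi * Real.Gamma ((r : ℝ) / 2 + n)) *
          InfoDensity.remainder r ρ n) ∧
    -- the series for `V` converges, and `V` obeys the error bound
    (∀ z : ℝ, 0 ≤ z → Summable (InfoDensity.termV r ρ z)) ∧
    (∀ (n : ℕ) (z : ℝ), 0 ≤ z →
      |InfoDensity.funV r ρ z - InfoDensity.approxV r ρ n z| ≤
        1 / 2 * InfoDensity.remainder r ρ n) ∧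
    -- the resulting error bound for the CDF of the information density
    (∀ (n : ℕ) (x : ℝ),
      |cdf (P.map (InfoDensity.infoDensity P X Y)) x - InfoDensity.approxCDF r ρ I n x| ≤
        1 / 2 * InfoDensity.remainder r ρ n) := by
  have hrC := hr.trans (InfoDensity.rank_coherenceMatrix hGauss hX hY).symm
  have hchar := InfoDensity.charFun_infoDensity_eq hGauss hX hY hac hrC
  rw [← hρ, ← hI] at hchar
  -- Singular values are indexed from 0, so with rank `r` the last positive one sits at `r - 1`.
  have hpos : 0 < ρ (r - 1) := by
    rw [hρ, InfoDensity.canonicalCorr, LinearMap.singularValues_pos_iff_lt_finrank_range,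
      InfoDensity.finrank_range_toEuclideanLin, ← hrC]
    omega
  have hanti : Antitone ρ := by
    rw [hρ]
    exact (Matrix.toEuclideanLin (InfoDensity.coherenceMatrix P X Y)).singularValues_antitone
  have hprob := InfoDensity.isProbabilityMeasure_infoDensityPDF hr2 hpos hanti I
  -- Both characteristic functions are `exp(i t I) ∏ (1 + ρ_i² t²)^(-1/2)`, and they determine the
  -- law.
  have hlaw : P.map (InfoDensity.infoDensity P X Y) = volume.withDensity
      fun x => ENNReal.ofReal (InfoDensity.infoDensityPDF r ρ I x) :=
    Measure.ext_of_charFun (funext fun t => by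
      rw [hchar, InfoDensity.charFun_infoDensityPDF hr2 hpos hanti])
  refine ⟨⟨InfoDensity.infoDensityPDF r ρ I, InfoDensity.continuous_infoDensityPDF hr2 hpos hanti I,
    InfoDensity.infoDensityPDF_nonneg hr2 hpos hanti I, hlaw,
    InfoDensity.abs_infoDensityPDF_sub_approxPDF_le hr2 hpos hanti I⟩,
    fun z hz => InfoDensity.summable_termV hr2 hpos hanti hz,
    fun n z hz => InfoDensity.abs_funV_sub_approxV_le hr2 hpos hanti n hz, fun n x => ?_⟩
  rw [hlaw]
  exact InfoDensity.abs_cdf_sub_approxCDF_le hr2 hpos hanti I n x
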